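/- Let $U\in C^2(\mathbb R)$ be a double-well potential: there are $x_-<x_0<x_+$ such that $U$ has local minima at $x_-$ and $x_+$ and a local maximum at $x_0$, and $U''(x_-),U''(x_0),U''(x_+)\neq 0$. Let $c_0>c_1$ be real, let $\lambda_0,\lambda_1>0$, and let $\xi=\xi(t)$, $t\ge 0$, be a right-continuous time-homogeneous Markov process with states $0,1$ and switching intensities $\lambda_0$ (from $0$ to $1$) and $\lambda_1$ (from $1$ to $0$), that is, $\mathbb P\{\xi(h)\ne i\mid \xi(0)=i\}=\lambda_i h+o(h)$ as $h\downarrow 0$. Let $\mathbb T(t)=\int_0^t c_{\xi(s)}\,ds$, and suppose that for every $x\in\mathbb R$ there is a continuous process $X=X^x(t)$ defined for all $t\ge 0$ (no blow-up) that solves $$dX(t)=-U'(X(t))\,dt+d\mathbb T(t),\qquad X(0)=x,$$ along every path of $\xi$. Put $$\Lambda=\begin{pmatrix}-\lambda_0&\lambda_0\\ \lambda_1&-\lambda_1\end{pmatrix},\qquad \mathcal L=\mathcal L^x=\begin{pmatrix}L_0^x&0\\0&L_1^x\end{pmatrix},\qquad L_i^x=(c_i-U'(x))\frac{\partial}{\partial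 x},\quad i\in\{0,1\}.$$ Theorem. $\Lambda$ is the generator of $\xi$, i.e. $\frac{d}{dt}\big|_{t=0+}\mathbb P\{\xi(t)=j\mid\xi(0)=i\}=\Lambda_{ij}$. The process $\Xi(t)=(X(t),\xi(t))$ is a time-homogeneous Markov process with state space $\mathbb R\times\{0,1\}$, and its infinitesimal generator is $\Lambda+\mathcal L$: with $$(P_t\boldsymbol f)_i(x)=\mathbb E\big[f_{\xi(t)}(X(t))\mid X(0)=x,\ \xi(0)=i\big],$$ for every $\boldsymbol f=(f_0,f_1)$ with $f_0,f_1\in C^1(\mathbb R)$ these expectations are finite and $$\lim_{h\downarrow 0}\frac{(P_h\boldsymbol f)_i(x)-f_i(x)}{h}=\big((\Lambda+\mathcal L)\boldsymbol f\big)_i(x)$$ locally uniformly in $(x,i)$, and uniformly in $(x,i)\in\mathbb R\times\{0,1\}$ if $f_0$ and $f_1$ have compact support. Moreover, the transition kernel matrix $\mathcal P(t,dy\mid x)=(p_{ij}(t,dy\mid x))_{i,j\in\{0,1\}}$, $$p_{ij}(t,dy\mid x)=\mathbb P\{X(t)\in dy,\ \xi(t)=j\mid X(0)=x,\ \xi(0)=i\},$$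 satisfies, tested against functions of $y$, $$\frac{\partial\mathcal P(t,dy\mid x)}{\partial t}=(\Lambda+\mathcal L^x)\,\mathcal P(t,dy\mid x),\qquad \mathcal P(t,dy\mid x)\big|_{t\downarrow 0}=\mathcal P(0,dy\mid x)=\begin{pmatrix}\delta_x(dy)&0\\0&\delta_x(dy)\end{pmatrix}.$$ Precisely: for every $\varphi\in C^1(\mathbb R)$ the matrix $\mathcal P_\varphi(t,x)=\int\varphi(y)\,\mathcal P(t,dy\mid x)$ is well defined (finite integrals) and continuously differentiable in $x$, and $\partial_t\mathcal P_\varphi(t,x)=(\Lambda+\mathcal L^x)\mathcal P_\varphi(t,x)$ for all $t\ge0$ (one-sided derivative at $t=0$) and $x\in\mathbb R$; the initial condition holds at $t=0$ exactly, and $\mathcal P_\varphi(t,x)\to\varphi(x)I$ as $t\downarrow 0$ for every continuous $\varphi$. -/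

import Mathlib

open MeasureTheory Set Filter Topology

noncomputable section

/-! ### Markov processes in continuous time -/

/-- The information generated by the process `Y` during the time interval `[0, t]`. -/
abbrev history {Ω E : Type*} [MeasurableSpace E] (Y : ℝ → Ω → E) (t : ℝ) : MeasurableSpace Ω :=
  ⨆ s ∈ Icc (0 : ℝ) t, MeasurableSpace.comap (Y s) inferInstance

/-- The law at time `t` of the process started from `e`, where `P e` is the probability given
that the starting point is `e` and `Y e` is the process with this starting point. -/
def transitionLaw {Ω E : Type*} [MeasurableSpace Ω] [MeasurableSpace E]
    (P : E → Measure Ω) (Y : E → ℝ → Ω → E) (t : ℝ) (e : E) : Measure E :=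
  (P e).map (Y e t)

/-- `Y e`, under `P e`, is for every `e` a time-homogeneous Markov process with state space `E`
started from `e`, and all of these have the same transition function.
Times are the nonnegative reals. -/
structure IsMarkovFamily {Ω E : Type*} [MeasurableSpace Ω] [MeasurableSpace E]
    (P : E → Measure Ω) (Y : E → ℝ → Ω → E) : Prop where
  prob : ∀ e, IsProbabilityMeasure (P e)
  measurable : ∀ e t, 0 ≤ t → Measurable (Y e t)
  start : ∀ e, ∀ᵐ ω ∂P e, Y e 0 ω = e
  measurable_transitionLaw : ∀ t, 0 ≤ t → Measurable (transitionLaw P Y t)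
  markov : ∀ e s t, 0 ≤ s → 0 ≤ t → ∀ A : Set Ω, MeasurableSet[history (Y e) s] A →
    ∀ B : Set E, MeasurableSet B →
      P e (A ∩ Y e (s + t) ⁻¹' B) = ∫⁻ ω in A, transitionLaw P Y t (Y e s ω) B ∂P e

/-- The semigroup `(P_t f)(e) = E[f(Y(t)) | Y(0) = e]`. -/
def markovSemigroup {Ω E : Type*} [MeasurableSpace Ω]
    (P : E → Measure Ω) (Y : E → ℝ → Ω → E) (t : ℝ) (f : E → ℝ) (e : E) : ℝ :=
  ∫ ω, f (Y e t ω) ∂P e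

/-! ### The telegraph process in a potential -/

/-- `ξ` is a right-continuous Markov process with the states `0, 1`, which leaves the state `i`
with intensity `lam i`. Here `P i` is the probability given `ξ(0) = i`. -/
structure IsSwitchingProcess {Ω : Type*} [MeasurableSpace Ω] (lam : Fin 2 → ℝ)
    (P : Fin 2 → Measure Ω) (ξ : ℝ → Ω → Fin 2) : Prop where
  markov : IsMarkovFamily P (fun _ => ξ)
  rightCont : ∀ ω t, 0 ≤ t → ContinuousWithinAt (fun s => ξ s ω) (Ici t) t
  intensity : ∀ i, Tendsto (fun h : ℝ => (P i).real {ω | ξ h ω ≠ i} / h) (𝓝[>] 0) (𝓝 (lam i))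

/-- A double-well potential of class `C²`, with local minima at `xm`, `xp` and a local maximum
at `x0`, all of them nondegenerate. -/
structure IsDoubleWell (U : ℝ → ℝ) (xm x0 xp : ℝ) : Prop where
  contDiff : ContDiff ℝ 2 U
  lt_left : xm < x0
  lt_right : x0 < xp
  localMin_left : IsLocalMin U xm
  localMax : IsLocalMax U x0
  localMin_right : IsLocalMin U xp
  nondeg : ∀ x ∈ ({xm, x0, xp} : Set ℝ), deriv (deriv U) x ≠ 0

/-- The telegraph process `𝕋(t) = ∫₀ᵗ c_{ξ(s)} ds` along the path `ξ`. -/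
def telegraph (c : Fin 2 → ℝ) (ξ : ℝ → Fin 2) (t : ℝ) : ℝ :=
  ∫ s in (0 : ℝ)..t, c (ξ s)

/-- Along the path `ξ`, the path `X` solves `dX(t) = -U'(X(t)) dt + d𝕋(t)`, `X(0) = x`,
for all times `t ≥ 0`. -/
structure SolvesTelegraphEquation (U : ℝ → ℝ) (c : Fin 2 → ℝ) (ξ : ℝ → Fin 2) (x : ℝ)
    (X : ℝ → ℝ) : Prop where
  cont : ContinuousOn X (Ici 0)
  eqn : ∀ t, 0 ≤ t → X t = x - (∫ s in (0 : ℝ)..t, deriv U (X s)) + telegraph c ξ t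

/-- The process `Ξ = (X^x(t), ξ(t))` with the starting point `z = (x, i)`
(to be considered under `P i`). -/
def jointProcess {Ω : Type*} (ξ : ℝ → Ω → Fin 2) (X : ℝ → ℝ → Ω → ℝ) (z : ℝ × Fin 2)
    (t : ℝ) (ω : Ω) : ℝ × Fin 2 :=
  (X z.1 t ω, ξ t ω)

/-- The measure `p_{ij}(t, dy | x) = P{X(t) ∈ dy, ξ(t) = j | X(0) = x, ξ(0) = i}`. -/
def transitionKernel {Ω : Type*} [MeasurableSpace Ω] (P : Fin 2 → Measure Ω)
    (ξ : ℝ → Ω → Fin 2) (X : ℝ → ℝ → Ω → ℝ) (t x : ℝ) (i j : Fin 2) : Measure ℝ :=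
  ((P i).restrict {ω | ξ t ω = j}).map (X x t)

/-- The matrix with the entries `∫ φ(y) p_{ij}(t, dy | x)`. -/
def kernelMatrix {Ω : Type*} [MeasurableSpace Ω] (P : Fin 2 → Measure Ω)
    (ξ : ℝ → Ω → Fin 2) (X : ℝ → ℝ → Ω → ℝ) (φ : ℝ → ℝ) (t x : ℝ) :
    Matrix (Fin 2) (Fin 2) ℝ :=
  Matrix.of fun i j => ∫ y, φ y ∂transitionKernel P ξ X t x i j

/-! ### The operators -/

/-- The matrix `Λ`. -/
def switchingMatrix (lam : Fin 2 → ℝ) : Matrix (Fin 2) (Fin 2) ℝ :=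
  !![-lam 0, lam 0; lam 1, -lam 1]

/-- `L_i = (c_i - U'(x)) ∂/∂x`. -/
def driftOp (U : ℝ → ℝ) (c : Fin 2 → ℝ) (i : Fin 2) (g : ℝ → ℝ) (x : ℝ) : ℝ :=
  (c i - deriv U x) * deriv g x

/-- `Λ + 𝓛`, with `𝓛 = diag(L_0, L_1)`, on vector functions `f = (f_0, f_1)`. -/
def telegraphGenerator (U : ℝ → ℝ) (c lam : Fin 2 → ℝ) (f : ℝ → Fin 2 → ℝ)
    (x : ℝ) (i : Fin 2) : ℝ :=
  (switchingMatrix lam).mulVec (f x) i + driftOp U c i (fun y => f y i) x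

/-- `Λ + 𝓛` on matrix functions: the product with `Λ`, and `L_i` applied to the `i`-th row. -/
def telegraphGeneratorMatrix (U : ℝ → ℝ) (c lam : Fin 2 → ℝ)
    (F : ℝ → Matrix (Fin 2) (Fin 2) ℝ) (x : ℝ) : Matrix (Fin 2) (Fin 2) ℝ :=
  switchingMatrix lam * F x + Matrix.of fun i j => driftOp U c i (fun y => F y i j) x

end

/-! Along a fixed path of `ξ` the equation is an ordinary differential equation, and everything
rests on comparing two of its solutions. The difference of the drifts is the average of `U''` over
the segment between the solutions times their difference, so an integrating factor solves the
equation for the difference (`hasDerivWithinAt_gap`). With a common driving path this gives `X^y(t)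
- X^x(t) = (y - x) exp(-∫ avg U'')`, hence differentiability in the starting point with derivative
`exp(-∫ U''(X))`. With ordered velocities it gives monotonicity. A path without switches up to a
given time exists for either state, since its probability is a limit `e^{-λT} > 0`; the two
corresponding solutions enclose all others (`exists_bound`). Thus on bounded times `X` is bounded
uniformly in `ω`, which makes the expectations finite and gives constant majorants for dominated
convergence.

Markov property: `X(s+t)` must be exhibited as a functional of `X(s)` and of `ξ` after time `s`. The
Euler scheme, which reads `ξ` only at grid points, converges to `X` along each path. For the scheme
the Markov property of `ξ` yields iterates of the one-step operator `eulerOp`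
(`integral_eulerPath`), and refining the grid gives `IsTelegraphFlow.integral_markov`. The same
approximation shows that `X` is adapted to the history of `ξ`.

Generator: `f(X(h), ξ(h)) - f(x, i)` splits into a change of state at fixed position, which produces
`Λ`, and a displacement in a fixed state, which produces `L_i`. The limit is taken jointly as `h ↓
0` and the starting point tends to `x`; this is local uniformity. For compact support, distant
starting points cannot reach the support in a short time.

Backward equation: differentiability of the flow makes `P_t f` of class `C¹`, so the generator
applies to it, and `P_{t+h} = P_h P_t` gives the right derivative at every `t`. This right
derivative is continuous in `t`, because `ξ` is stochastically continuous, hence it is a derivative.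
The column `j` of the kernel matrix is the semigroup applied to `φ` placed in component `j`. -/

/-! ### The mean value of a derivative along a segment -/

/-- The average of `g'` over the segment from `p` to `q`. -/
noncomputable def avgDeriv (g : ℝ → ℝ) (p q : ℝ) : ℝ :=
  ∫ θ in (0 : ℝ)..1, deriv g (p + θ * (q - p))

/-- The integral form, unlike the difference quotient, is continuous across the diagonal `p = q`;
this supplies both limits of difference quotients and bounds on compact squares. -/
theorem continuous_avgDeriv {g : ℝ → ℝ} (hg : ContDiff ℝ 1 g) :
    Continuous fun p : ℝ × ℝ => avgDeriv g p.1 p.2 := by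
  have h : Continuous (deriv g) := hg.continuous_deriv le_rfl
  unfold avgDeriv
  apply intervalIntegral.continuous_parametric_intervalIntegral_of_continuous'
    (f := fun (p : ℝ × ℝ) θ => deriv g (p.1 + θ * (p.2 - p.1)))
  unfold Function.uncurry
  fun_prop

@[simp]
theorem avgDeriv_self (g : ℝ → ℝ) (p : ℝ) : avgDeriv g p p = deriv g p := by
  simp [avgDeriv]

theorem avgDeriv_mul_sub {g : ℝ → ℝ} (hg : ContDiff ℝ 1 g) (p q : ℝ) :
    avgDeriv g p q * (q - p) = g q - g p := by
  have h : Continuous (deriv g) := hg.continuous_deriv le_rfl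
  have hd : ∀ θ ∈ uIcc (0 : ℝ) 1, HasDerivAt (fun θ : ℝ => g (p + θ * (q - p)))
      (deriv g (p + θ * (q - p)) * (q - p)) θ := by
    intro θ _
    have h1 : HasDerivAt (fun θ : ℝ => p + θ * (q - p)) (q - p) θ := by
      simpa using ((hasDerivAt_id θ).mul_const (q - p)).const_add p
    exact ((hg.differentiable one_ne_zero _).hasDerivAt).comp θ h1
  have hi : IntervalIntegrable (fun θ : ℝ => deriv g (p + θ * (q - p)) * (q - p)) volume 0 1 :=
    Continuous.intervalIntegrable (by fun_prop) _ _
  have := intervalIntegral.integral_eq_sub_of_hasDerivAt hd hi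
  rw [intervalIntegral.integral_mul_const] at this
  simpa [avgDeriv] using this

/-! ### Right-continuous switching paths -/

/-- The path `η` is right-continuous on `[0, ∞)`. -/
def RightContPath (η : ℝ → Fin 2) : Prop :=
  ∀ t, 0 ≤ t → ContinuousWithinAt η (Ici t) t

namespace RightContPath

variable {η : ℝ → Fin 2}

theorem eventually_eq (hη : RightContPath η) {t : ℝ} (ht : 0 ≤ t) :
    ∀ᶠ s in 𝓝[≥] t, η s = η t := by
  have := hη t ht
  rw [ContinuousWithinAt, nhds_discrete, tendsto_pure] at this
  exact this

theorem shift (hη : RightContPath η) {s : ℝ} (hs : 0 ≤ s) :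
    RightContPath (fun u => η (s + u)) := by
  intro t ht
  refine (hη (s + t) (by positivity)).comp (f := fun u => s + u) (by fun_prop) ?_
  intro u hu
  simpa using hu

/-- The grid points to the right of `s` tend to `s` from the right. -/
theorem tendsto_grid {s T : ℝ} (hT : 0 < T) :
    Tendsto (fun n : ℕ => ((⌊s / (T / (n + 1))⌋ : ℝ) + 1) * (T / (n + 1))) atTop (𝓝[≥] s) := by
  have hpos : ∀ n : ℕ, 0 < T / ((n : ℝ) + 1) := fun n => by positivity
  rw [tendsto_nhdsWithin_iff]
  constructor
  · have h0 : Tendsto (fun n : ℕ => s + T * (1 / ((n : ℝ) + 1))) atTop (𝓝 (s + T * 0)) :=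
      (tendsto_one_div_add_atTop_nhds_zero_nat.const_mul T).const_add s
    rw [mul_zero, add_zero] at h0
    refine tendsto_of_tendsto_of_tendsto_of_le_of_le tendsto_const_nhds h0 ?_ ?_
    · intro n
      have := Int.lt_floor_add_one (s / (T / ((n : ℝ) + 1)))
      rw [div_lt_iff₀ (hpos n)] at this
      exact this.le
    · intro n
      have := Int.floor_le (s / (T / ((n : ℝ) + 1)))
      rw [le_div_iff₀ (hpos n)] at this
      have e : T * (1 / ((n : ℝ) + 1)) = T / (n + 1) := by ring
      simp only [e]
      nlinarith
  · refine Eventually.of_forall fun n => ?_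
    have := Int.lt_floor_add_one (s / (T / ((n : ℝ) + 1)))
    rw [div_lt_iff₀ (hpos n)] at this
    exact this.le

theorem tendsto_comp_grid (hη : RightContPath η) (c : Fin 2 → ℝ) {s T : ℝ} (hs : 0 ≤ s)
    (hT : 0 < T) :
    Tendsto (fun n : ℕ => c (η (((⌊s / (T / (n + 1))⌋ : ℝ) + 1) * (T / (n + 1))))) atTop
      (𝓝 (c (η s))) := by
  refine tendsto_const_nhds.congr' ?_
  filter_upwards [(tendsto_grid hT).eventually (hη.eventually_eq hs)] with n hn
  rw [hn]

/-- Reading `η` at the next grid point gives a function of an integer part, hence a measurable one,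
and right-continuity makes these converge pointwise. The argument is cut off at `0` because nothing
is known about `η` at negative times. -/
theorem measurable_comp (hη : RightContPath η) (c : Fin 2 → ℝ) :
    Measurable fun s => c (η (max s 0)) := by
  refine measurable_of_tendsto_metrizable (f := fun (n : ℕ) (s : ℝ) =>
    c (η (((⌊max s 0 / (1 / (n + 1))⌋ : ℝ) + 1) * (1 / (n + 1))))) (fun n => ?_) ?_
  · have h1 : Measurable fun s : ℝ => ⌊max s 0 / (1 / ((n : ℝ) + 1))⌋ :=
      Int.measurable_floor.comp (by fun_prop)
    exact (measurable_of_countable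
      (fun k : ℤ => c (η (((k : ℝ) + 1) * (1 / ((n : ℝ) + 1)))))).comp h1
  · rw [tendsto_pi_nhds]
    intro s
    exact hη.tendsto_comp_grid c (le_max_right _ _) one_pos

theorem abs_apply_le (c : Fin 2 → ℝ) (i : Fin 2) : |c i| ≤ |c 0| + |c 1| := by
  fin_cases i <;> simp

theorem intervalIntegrable (hη : RightContPath η) (c : Fin 2 → ℝ) {a b : ℝ} (ha : 0 ≤ a)
    (hb : 0 ≤ b) : IntervalIntegrable (fun s => c (η s)) volume a b := by
  have h : IntervalIntegrable (fun s => c (η (max s 0))) volume a b := by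
    refine (intervalIntegrable_const (c := |c 0| + |c 1|)).mono_fun
      (hη.measurable_comp c).aestronglyMeasurable (Eventually.of_forall fun s => ?_)
    simp only [Real.norm_eq_abs]
    exact (abs_apply_le c _).trans (le_abs_self _)
  refine h.congr fun s hs => ?_
  have : 0 ≤ s := (le_min ha hb).trans hs.1.le
  simp [max_eq_left this]

theorem hasDerivWithinAt_telegraph (hη : RightContPath η) (c : Fin 2 → ℝ) {t : ℝ}
    (ht : 0 ≤ t) : HasDerivWithinAt (telegraph c η) (c (η t)) (Ici t) t := by
  refine intervalIntegral.integral_hasDerivWithinAt_right (hη.intervalIntegrable c le_rfl ht)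
    (t := Ioi t) ?_ ?_
  · refine ⟨Ioi t, self_mem_nhdsWithin, ?_⟩
    refine (hη.measurable_comp c).aestronglyMeasurable.congr ?_
    filter_upwards [ae_restrict_mem measurableSet_Ioi] with s hs
    simp [max_eq_left (ht.trans (le_of_lt hs))]
  · exact ((continuous_of_discreteTopology (f := c)).continuousAt.comp_continuousWithinAt
      (hη t ht)).mono Ioi_subset_Ici_self

end RightContPath

/-! ### Solutions of the telegraph equation -/

namespace SolvesTelegraphEquation

variable {U : ℝ → ℝ} {c : Fin 2 → ℝ} {η η₁ η₂ : ℝ → Fin 2} {x x₁ x₂ : ℝ} {Y Y₁ Y₂ : ℝ → ℝ}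

theorem apply_zero (hY : SolvesTelegraphEquation U c η x Y) : Y 0 = x := by
  simpa [telegraph] using hY.eqn 0 le_rfl

/-- Freezing the path before time `0` gives a function continuous on the whole line. -/
theorem continuous_max (hY : SolvesTelegraphEquation U c η x Y) :
    Continuous fun s => Y (max s 0) :=
  hY.cont.comp_continuous (by fun_prop) fun s => mem_Ici.2 (le_max_right _ _)

theorem intervalIntegrable_comp (hY : SolvesTelegraphEquation U c η x Y) {g : ℝ → ℝ}
    (hg : Continuous g) {a b : ℝ} (ha : 0 ≤ a) (hb : 0 ≤ b) :
    IntervalIntegrable (fun s => g (Y s)) volume a b := by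
  refine ContinuousOn.intervalIntegrable (hg.comp_continuousOn (hY.cont.mono ?_))
  intro s hs
  exact (le_min ha hb).trans hs.1

theorem hasDerivWithinAt_integral {g : ℝ → ℝ} (hg : ContinuousOn g (Ici 0)) {t : ℝ}
    (ht : 0 ≤ t) : HasDerivWithinAt (fun t => ∫ s in (0 : ℝ)..t, g s) (g t) (Ici 0) t := by
  have hc : Continuous fun s => g (max s 0) :=
    hg.comp_continuous (by fun_prop) fun s => mem_Ici.2 (le_max_right _ _)
  have h := ((intervalIntegral.integral_hasDerivAt_right (hc.intervalIntegrable 0 t)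
    hc.stronglyMeasurable.stronglyMeasurableAtFilter hc.continuousAt).hasDerivWithinAt
    (s := Ici 0))
  rw [max_eq_left ht] at h
  have e : ∀ t ∈ Ici (0 : ℝ), (∫ s in (0 : ℝ)..t, g s) = ∫ s in (0 : ℝ)..t, g (max s 0) := by
    intro t ht
    refine intervalIntegral.integral_congr fun s hs => ?_
    rw [uIcc_of_le ht] at hs
    simp [max_eq_left hs.1]
  exact h.congr e (e t ht)

theorem hasDerivWithinAt (hU : ContDiff ℝ 1 (deriv U)) (hη : RightContPath η)
    (hY : SolvesTelegraphEquation U c η x Y) {t : ℝ} (ht : 0 ≤ t) :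
    HasDerivWithinAt Y (c (η t) - deriv U (Y t)) (Ici t) t := by
  have h1 := (hasDerivWithinAt_integral (hU.continuous.comp_continuousOn hY.cont) ht).mono
    (Ici_subset_Ici.2 ht)
  have h := ((h1.const_sub x).add (hη.hasDerivWithinAt_telegraph c ht)).congr
    (f₁ := Y) (fun s hs => hY.eqn s (ht.trans hs)) (hY.eqn t ht)
  simpa [sub_eq_neg_add, add_comm] using h

/-- The exponent of the integrating factor for the difference of two solutions. -/
noncomputable def gapExponent (U : ℝ → ℝ) (Y₁ Y₂ : ℝ → ℝ) (t : ℝ) : ℝ :=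
  ∫ s in (0 : ℝ)..t, avgDeriv (deriv U) (Y₁ s) (Y₂ s)

theorem continuousOn_avgDeriv (hU : ContDiff ℝ 1 (deriv U))
    (h₁ : SolvesTelegraphEquation U c η₁ x₁ Y₁) (h₂ : SolvesTelegraphEquation U c η₂ x₂ Y₂) :
    ContinuousOn (fun s => avgDeriv (deriv U) (Y₁ s) (Y₂ s)) (Ici 0) :=
  (continuous_avgDeriv hU).comp_continuousOn (h₁.cont.prodMk h₂.cont)

/-- By the mean value formula the drifts contribute `-avgDeriv * (Y₂ - Y₁)`, which the integrating
factor cancels; only the difference of the velocities survives. The derivatives are from the right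
because the velocities jump. -/
theorem hasDerivWithinAt_gap (hU : ContDiff ℝ 1 (deriv U)) (hη₁ : RightContPath η₁)
    (hη₂ : RightContPath η₂)
    (h₁ : SolvesTelegraphEquation U c η₁ x₁ Y₁) (h₂ : SolvesTelegraphEquation U c η₂ x₂ Y₂)
    {t : ℝ} (ht : 0 ≤ t) :
    HasDerivWithinAt (fun s => (Y₂ s - Y₁ s) * Real.exp (gapExponent U Y₁ Y₂ s))
      ((c (η₂ t) - c (η₁ t)) * Real.exp (gapExponent U Y₁ Y₂ t)) (Ici t) t := by
  have hA : HasDerivWithinAt (gapExponent U Y₁ Y₂) (avgDeriv (deriv U) (Y₁ t) (Y₂ t)) (Ici t) t :=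
    (hasDerivWithinAt_integral (continuousOn_avgDeriv hU h₁ h₂) ht).mono (Ici_subset_Ici.2 ht)
  refine (((h₂.hasDerivWithinAt hU hη₂ ht).sub
    (h₁.hasDerivWithinAt hU hη₁ ht)).mul hA.exp).congr_deriv ?_
  have := avgDeriv_mul_sub hU (Y₁ t) (Y₂ t)
  simp only [Pi.sub_apply]
  linear_combination Real.exp (gapExponent U Y₁ Y₂ t) * this

theorem continuousOn_gap (hU : ContDiff ℝ 1 (deriv U))
    (h₁ : SolvesTelegraphEquation U c η₁ x₁ Y₁) (h₂ : SolvesTelegraphEquation U c η₂ x₂ Y₂) :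
    ContinuousOn (fun s => (Y₂ s - Y₁ s) * Real.exp (gapExponent U Y₁ Y₂ s)) (Ici 0) := by
  refine (h₂.cont.sub h₁.cont).mul (Real.continuous_exp.comp_continuousOn ?_)
  exact fun t ht => (hasDerivWithinAt_integral (continuousOn_avgDeriv hU h₁ h₂)
    ht).continuousWithinAt

/-- With a common driving path the right-hand side of `hasDerivWithinAt_gap` is zero, so the product
of the gap and the integrating factor is constant. -/
theorem gap_eq (hU : ContDiff ℝ 1 (deriv U)) (hη : RightContPath η)
    (h₁ : SolvesTelegraphEquation U c η x₁ Y₁) (h₂ : SolvesTelegraphEquation U c η x₂ Y₂)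
    {t : ℝ} (ht : 0 ≤ t) :
    Y₂ t - Y₁ t = (x₂ - x₁) * Real.exp (-gapExponent U Y₁ Y₂ t) := by
  have h := constant_of_has_deriv_right_zero
    ((continuousOn_gap hU h₁ h₂).mono (Icc_subset_Ici_self : Icc 0 t ⊆ Ici 0))
    (fun s hs => (hasDerivWithinAt_gap hU hη hη h₁ h₂ hs.1).congr_deriv (by simp))
    t ⟨ht, le_rfl⟩
  rw [h₁.apply_zero, h₂.apply_zero] at h
  rw [Real.exp_neg, ← div_eq_mul_inv, eq_div_iff (Real.exp_ne_zero _), h]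
  simp [gapExponent]

/-- With ordered velocities the same product has nonnegative right derivative, so it stays above its
initial value `x₂ - x₁ ≥ 0`. -/
theorem le_of_le (hU : ContDiff ℝ 1 (deriv U)) (hη₁ : RightContPath η₁)
    (hη₂ : RightContPath η₂) (hx : x₁ ≤ x₂)
    (h₁ : SolvesTelegraphEquation U c η₁ x₁ Y₁) (h₂ : SolvesTelegraphEquation U c η₂ x₂ Y₂)
    {t : ℝ} (ht : 0 ≤ t) (hc : ∀ s ∈ Ico 0 t, c (η₁ s) ≤ c (η₂ s)) : Y₁ t ≤ Y₂ t := by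
  have h := image_le_of_deriv_right_le_deriv_boundary (a := 0) (b := t)
    (continuousOn_const (c := (0 : ℝ))) (fun s _ => hasDerivWithinAt_const s _ (0 : ℝ))
    (by simpa [h₁.apply_zero, h₂.apply_zero, gapExponent] using hx)
    ((continuousOn_gap hU h₁ h₂).mono (Icc_subset_Ici_self : Icc 0 t ⊆ Ici 0))
    (fun s hs => hasDerivWithinAt_gap hU hη₁ hη₂ h₁ h₂ hs.1)
    (fun s hs => mul_nonneg (sub_nonneg.2 (hc s hs)) (Real.exp_pos _).le) ⟨ht, le_rfl⟩
  have := nonneg_of_mul_nonneg_left h (Real.exp_pos _)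
  linarith

theorem shift (hη : RightContPath η) (hU : ContDiff ℝ 1 (deriv U))
    (hY : SolvesTelegraphEquation U c η x Y) {s : ℝ} (hs : 0 ≤ s) :
    SolvesTelegraphEquation U c (fun u => η (s + u)) (Y s) (fun u => Y (s + u)) where
  cont := hY.cont.comp (by fun_prop) fun u hu => add_nonneg hs hu
  eqn t ht := by
    have hst : 0 ≤ s + t := add_nonneg hs ht
    have e1 : (∫ u in (0 : ℝ)..t, deriv U (Y (s + u))) = ∫ u in s..(s + t), deriv U (Y u) := by
      simpa using intervalIntegral.integral_comp_add_left (fun u => deriv U (Y u)) s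
        (a := 0) (b := t)
    have e2 : telegraph c (fun u => η (s + u)) t = ∫ u in s..(s + t), c (η u) := by
      simpa [telegraph] using intervalIntegral.integral_comp_add_left (fun u => c (η u)) s
        (a := 0) (b := t)
    have i1 := intervalIntegral.integral_add_adjacent_intervals
      (hY.intervalIntegrable_comp hU.continuous le_rfl hs)
      (hY.intervalIntegrable_comp hU.continuous hs hst)
    have i2 := intervalIntegral.integral_add_adjacent_intervals
      (hη.intervalIntegrable c le_rfl hs) (hη.intervalIntegrable c hs hst)
    have q1 := hY.eqn s hs
    have q2 := hY.eqn (s + t) hst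
    simp only [telegraph] at q1 q2 e2 ⊢
    rw [e1, e2, q2, ← i1, ← i2]
    linarith

/-- A bound for the increments of a solution in a region where the velocity is bounded. -/
theorem abs_sub_le (hU : ContDiff ℝ 1 (deriv U)) (hη : RightContPath η)
    (hY : SolvesTelegraphEquation U c η x Y) {s t V : ℝ} (hs : 0 ≤ s) (hst : s ≤ t)
    (hV : ∀ u ∈ Icc s t, |c (η u) - deriv U (Y u)| ≤ V) : |Y t - Y s| ≤ V * (t - s) := by
  have := norm_image_sub_le_of_norm_deriv_right_le_segment (f := Y) (a := s) (b := t)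
    (hY.cont.mono fun u hu => hs.trans hu.1)
    (fun u hu => hY.hasDerivWithinAt hU hη (hs.trans hu.1))
    (fun u hu => hV u ⟨hu.1, hu.2.le⟩) t ⟨hst, le_rfl⟩
  simpa using this

end SolvesTelegraphEquation

/-! ### The Euler scheme -/

/-- The drift `-U'`, frozen outside of `[-R, R]`. -/
noncomputable def clampedDrift (U : ℝ → ℝ) (R y : ℝ) : ℝ :=
  -deriv U (max (-R) (min R y))

/-- A step of length `h` of the Euler scheme. -/
noncomputable def eulerStep (U : ℝ → ℝ) (c : Fin 2 → ℝ) (R h z : ℝ) (j : Fin 2) : ℝ :=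
  z + h * (c j + clampedDrift U R z)

/-- The Euler scheme with step `h` along the path `η`; the velocity on a step is read off at
its right end. -/
noncomputable def eulerPath (U : ℝ → ℝ) (c : Fin 2 → ℝ) (R h : ℝ) (η : ℝ → Fin 2) (y : ℝ) :
    ℕ → ℝ
  | 0 => y
  | k + 1 => eulerStep U c R h (eulerPath U c R h η y k) (η (((k : ℝ) + 1) * h))

section Euler

variable {U : ℝ → ℝ} {c : Fin 2 → ℝ} {R : ℝ}

theorem clampedDrift_of_abs_le {y : ℝ} (hy : |y| ≤ R) : clampedDrift U R y = -deriv U y := by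
  rw [abs_le] at hy
  simp [clampedDrift, hy.1, hy.2]

theorem continuous_clampedDrift (hU : Continuous (deriv U)) : Continuous (clampedDrift U R) := by
  unfold clampedDrift
  fun_prop

theorem continuous_eulerStep (hU : Continuous (deriv U)) (h : ℝ) (j : Fin 2) :
    Continuous fun z => eulerStep U c R h z j := by
  have := continuous_clampedDrift (R := R) hU
  unfold eulerStep
  fun_prop

theorem clamp_mem_Icc (hR : 0 ≤ R) (y : ℝ) : max (-R) (min R y) ∈ Icc (-R) R :=
  ⟨le_max_left _ _, max_le (by linarith) (min_le_left _ _)⟩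

/-- The clamp exists for the sake of these bounds: `-U'` itself need not be bounded or Lipschitz,
and an Euler path may leave `[-R, R]` even when the solution does not. -/
theorem exists_clampedDrift_bounds (hU : ContDiff ℝ 1 (deriv U)) (c : Fin 2 → ℝ) (hR : 0 ≤ R) :
    ∃ L V : ℝ, 0 ≤ L ∧ 0 ≤ V ∧
      (∀ y z, |clampedDrift U R y - clampedDrift U R z| ≤ L * |y - z|) ∧
      ∀ i y, |c i + clampedDrift U R y| ≤ V := by
  obtain ⟨L, hL⟩ := (isCompact_Icc.prod isCompact_Icc).exists_bound_of_continuousOn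
    (s := Icc (-R) R ×ˢ Icc (-R) R) (continuous_avgDeriv hU).continuousOn
  obtain ⟨W, hW⟩ := isCompact_Icc.exists_bound_of_continuousOn (s := Icc (-R) R)
    hU.continuous.continuousOn
  have h0 : (0 : ℝ) ∈ Icc (-R) R := ⟨by linarith, hR⟩
  have hL0 : 0 ≤ L := (norm_nonneg _).trans (hL (0, 0) ⟨h0, h0⟩)
  have hW0 : 0 ≤ W := (norm_nonneg _).trans (hW 0 h0)
  refine ⟨L, |c 0| + |c 1| + W, hL0, by positivity, fun y z => ?_, fun i y => ?_⟩
  · have e : clampedDrift U R y - clampedDrift U R z =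
        deriv U (max (-R) (min R z)) - deriv U (max (-R) (min R y)) := by
      simp only [clampedDrift]; ring
    rw [e, ← avgDeriv_mul_sub hU, abs_mul]
    refine mul_le_mul (hL (_, _) ⟨clamp_mem_Icc hR _, clamp_mem_Icc hR _⟩) ?_ (abs_nonneg _) hL0
    refine (abs_max_sub_max_le_max _ _ _ _).trans ?_
    refine max_le (by simp) ((abs_min_sub_min_le_max _ _ _ _).trans ?_)
    exact max_le (by simp) (abs_sub_comm _ _).le
  · refine (abs_add_le _ _).trans (add_le_add (RightContPath.abs_apply_le c i) ?_)
    rw [clampedDrift, abs_neg]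
    exact hW _ (clamp_mem_Icc hR _)

theorem abs_eulerPath_sub_le {V h : ℝ} (hV : ∀ i y, |c i + clampedDrift U R y| ≤ V)
    (hh : 0 ≤ h) (η : ℝ → Fin 2) (y : ℝ) (k : ℕ) :
    |eulerPath U c R h η y k - y| ≤ V * (k * h) := by
  induction k with
  | zero => simp [eulerPath]
  | succ k ih =>
    have e : eulerPath U c R h η y (k + 1) - y = (eulerPath U c R h η y k - y) +
        h * (c (η (((k : ℝ) + 1) * h)) + clampedDrift U R (eulerPath U c R h η y k)) := by
      simp only [eulerPath, eulerStep]; ring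
    rw [e]
    refine (abs_add_le _ _).trans ((add_le_add ih (?_ : _ ≤ h * V)).trans_eq ?_)
    · rw [abs_mul, abs_of_nonneg hh]
      exact mul_le_mul_of_nonneg_left (hV _ _) hh
    · push_cast; ring

/-- The error made by reading off the path `η` at the right end of a grid interval. -/
noncomputable def gridError (c : Fin 2 → ℝ) (η : ℝ → Fin 2) (h s : ℝ) : ℝ :=
  |c (η s) - c (η (((⌊s / h⌋ : ℝ) + 1) * h))|

theorem gridError_nonneg (η : ℝ → Fin 2) (h s : ℝ) : 0 ≤ gridError c η h s := abs_nonneg _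

theorem gridError_le (η : ℝ → Fin 2) (h s : ℝ) :
    gridError c η h s ≤ 2 * (|c 0| + |c 1|) := by
  refine (abs_sub _ _).trans ?_
  have h1 := RightContPath.abs_apply_le c (η s)
  have h2 := RightContPath.abs_apply_le c (η (((⌊s / h⌋ : ℝ) + 1) * h))
  linarith

theorem measurable_gridError_max {η : ℝ → Fin 2} (hη : RightContPath η) (h : ℝ) :
    Measurable fun s => gridError c η h (max s 0) := by
  have h1 : Measurable fun s : ℝ => ⌊max s 0 / h⌋ := Int.measurable_floor.comp (by fun_prop)
  have h2 : Measurable fun s : ℝ => c (η (((⌊max s 0 / h⌋ : ℝ) + 1) * h)) :=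
    (measurable_of_countable (fun k : ℤ => c (η (((k : ℝ) + 1) * h)))).comp h1
  exact ((hη.measurable_comp c).sub h2).norm

theorem aestronglyMeasurable_gridError {η : ℝ → Fin 2} (hη : RightContPath η) (h : ℝ) {a b : ℝ}
    (ha : 0 ≤ a) (hb : 0 ≤ b) :
    AEStronglyMeasurable (gridError c η h) (volume.restrict (uIoc a b)) := by
  refine (measurable_gridError_max (c := c) hη h).aestronglyMeasurable.congr ?_
  filter_upwards [ae_restrict_mem measurableSet_uIoc] with s hs
  have : 0 ≤ s := (le_min ha hb).trans hs.1.le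
  simp [max_eq_left this]

theorem intervalIntegrable_gridError {η : ℝ → Fin 2} (hη : RightContPath η) (h : ℝ) {a b : ℝ}
    (ha : 0 ≤ a) (hb : 0 ≤ b) : IntervalIntegrable (gridError c η h) volume a b := by
  refine (intervalIntegrable_const (c := 2 * (|c 0| + |c 1|))).mono_fun
    (aestronglyMeasurable_gridError hη h ha hb) (Eventually.of_forall fun s => ?_)
  simp only [Real.norm_eq_abs]
  rw [abs_of_nonneg (gridError_nonneg _ _ _)]
  exact (gridError_le η h s).trans (le_abs_self _)

/-- Discrete Gronwall argument: a step multiplies the old error by at most `1 + h * L` and adds the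
grid error of its interval and `L * V * h ^ 2`. The common factor `(1 + h * L) ^ k` in front of all
contributions is crude but closes the induction. -/
theorem abs_eulerPath_sub_solution_le {η : ℝ → Fin 2} {x : ℝ} {Y : ℝ → ℝ}
    (hU : ContDiff ℝ 1 (deriv U)) (hη : RightContPath η)
    (hY : SolvesTelegraphEquation U c η x Y) {t L V h : ℝ} (hL0 : 0 ≤ L) (hV0 : 0 ≤ V)
    (hL : ∀ y z, |clampedDrift U R y - clampedDrift U R z| ≤ L * |y - z|)
    (hV : ∀ i y, |c i + clampedDrift U R y| ≤ V)
    (hYR : ∀ s ∈ Icc 0 t, |Y s| ≤ R) (hh : 0 < h) (k : ℕ) (hk : k * h ≤ t) :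
    |eulerPath U c R h η x k - Y (k * h)| ≤
      (1 + h * L) ^ k * ((∫ s in (0 : ℝ)..(k * h), gridError c η h s) + k * (L * V * h ^ 2)) := by
  induction k with
  | zero => simp [eulerPath, hY.apply_zero]
  | succ k ih =>
    push_cast at hk ⊢
    have hab : (k : ℝ) * h ≤ (k + 1) * h := by nlinarith
    have ha0 : 0 ≤ (k : ℝ) * h := by positivity
    have hb0 : 0 ≤ ((k : ℝ) + 1) * h := by positivity
    have ih := ih (hab.trans hk)
    set a := (k : ℝ) * h with ha
    set b := ((k : ℝ) + 1) * h with hb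
    have hba : b - a = h := by rw [ha, hb]; ring
    set z := eulerPath U c R h η x k with hz
    have hE : eulerPath U c R h η x (k + 1) = z + h * (c (η b) + clampedDrift U R z) := rfl
    have i1 := intervalIntegral.integral_add_adjacent_intervals
      (hY.intervalIntegrable_comp hU.continuous le_rfl ha0)
      (hY.intervalIntegrable_comp hU.continuous ha0 hb0)
    have i2 := intervalIntegral.integral_add_adjacent_intervals
      (hη.intervalIntegrable c le_rfl ha0) (hη.intervalIntegrable c ha0 hb0)
    have q1 := hY.eqn a ha0
    have q2 := hY.eqn b hb0
    simp only [telegraph] at q1 q2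
    have j1 : (∫ s in a..b, (c (η b) - c (η s))) = h * c (η b) - ∫ s in a..b, c (η s) := by
      rw [intervalIntegral.integral_sub intervalIntegrable_const
        (hη.intervalIntegrable c ha0 hb0)]
      simp [hba]
    have j2 : (∫ s in a..b, (deriv U (Y s) - deriv U (Y a))) =
        (∫ s in a..b, deriv U (Y s)) - h * deriv U (Y a) := by
      rw [intervalIntegral.integral_sub (hY.intervalIntegrable_comp hU.continuous ha0 hb0)
        intervalIntegrable_const]
      simp [hba]
    -- The solution stays in `[-R, R]`, so the clamp does not act on it.
    have hcl : ∀ s ∈ Icc a b, clampedDrift U R (Y s) = -deriv U (Y s) := fun s hs =>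
      clampedDrift_of_abs_le (hYR s ⟨ha0.trans hs.1, hs.2.trans hk⟩)
    have key : eulerPath U c R h η x (k + 1) - Y b = (z - Y a) +
        h * (clampedDrift U R z - clampedDrift U R (Y a)) +
        (∫ s in a..b, (c (η b) - c (η s))) +
        ∫ s in a..b, (deriv U (Y s) - deriv U (Y a)) := by
      rw [hE, j1, j2, hcl a ⟨le_rfl, hab⟩]
      linear_combination q1 - q2 - i1 + i2
    have b1 : |∫ s in a..b, (c (η b) - c (η s))| ≤ ∫ s in a..b, gridError c η h s := by
      refine (intervalIntegral.abs_integral_le_integral_abs hab).trans_eq ?_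
      refine intervalIntegral.integral_congr_ae ?_
      -- At `s = b` the integer part jumps to `k + 1` and the grid point would be the next one; this
      -- single point is negligible.
      have hne : ∀ᵐ s : ℝ, s ≠ b := by simp [ae_iff]
      filter_upwards [hne] with s hsb hs
      rw [uIoc_of_le hab] at hs
      have hs2 : s < b := lt_of_le_of_ne hs.2 hsb
      have hf : ⌊s / h⌋ = (k : ℤ) := by
        rw [Int.floor_eq_iff, le_div_iff₀ hh, div_lt_iff₀ hh]
        push_cast
        exact ⟨hs.1.le, hs2⟩
      rw [gridError, hf, abs_sub_comm]
      simp [hb]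
    have hYs : ∀ s ∈ Icc a b, |Y s - Y a| ≤ V * h := fun s hs => by
      refine (hY.abs_sub_le hU hη ha0 hs.1 fun u hu => ?_).trans
        (mul_le_mul_of_nonneg_left (by linarith [hs.2]) hV0)
      rw [sub_eq_add_neg, ← hcl u ⟨hu.1, hu.2.trans hs.2⟩]
      exact hV _ _
    -- During the step `Y` moves by at most `V * h`, so the drift changes by at most `L * (V * h)`,
    -- over a time `h`.
    have b2 : |∫ s in a..b, (deriv U (Y s) - deriv U (Y a))| ≤ L * V * h ^ 2 := by
      have := intervalIntegral.norm_integral_le_of_norm_le_const (a := a) (b := b)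
        (f := fun s => deriv U (Y s) - deriv U (Y a)) (C := L * (V * h)) fun s hs => by
          rw [uIoc_of_le hab] at hs
          have hs' : s ∈ Icc a b := ⟨hs.1.le, hs.2⟩
          have h2 := hL (Y a) (Y s)
          rw [hcl s hs', hcl a ⟨le_rfl, hab⟩, abs_sub_comm (Y a)] at h2
          rw [Real.norm_eq_abs]
          refine le_trans (le_of_eq ?_) (h2.trans (mul_le_mul_of_nonneg_left (hYs s hs') hL0))
          congr 1; ring
      rw [hba, abs_of_pos hh] at this
      refine this.trans_eq (by ring)
    have b3 : |h * (clampedDrift U R z - clampedDrift U R (Y a))| ≤ h * L * |z - Y a| := by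
      rw [abs_mul, abs_of_pos hh, mul_assoc]
      exact mul_le_mul_of_nonneg_left (hL _ _) hh.le
    have i3 := intervalIntegral.integral_add_adjacent_intervals
      (intervalIntegrable_gridError (c := c) hη h le_rfl ha0)
      (intervalIntegrable_gridError (c := c) hη h ha0 hb0)
    have hΦ : 0 ≤ ∫ s in a..b, gridError c η h s :=
      intervalIntegral.integral_nonneg hab fun s _ => gridError_nonneg _ _ _
    rw [key, ← i3]
    set I := ∫ s in (0 : ℝ)..a, gridError c η h s
    set δ := ∫ s in a..b, gridError c η h s
    have hone : 1 ≤ (1 + h * L) ^ (k + 1) := one_le_pow₀ (by nlinarith [mul_nonneg hh.le hL0])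
    have hrest : 0 ≤ δ + L * V * h ^ 2 := by positivity
    calc _ ≤ (1 + h * L) * |z - Y a| + (δ + L * V * h ^ 2) := by
          refine (abs_add_le _ _).trans ?_
          have := (abs_add_le (z - Y a + h * (clampedDrift U R z - clampedDrift U R (Y a)))
            (∫ s in a..b, (c (η b) - c (η s))))
          have := (abs_add_le (z - Y a) (h * (clampedDrift U R z - clampedDrift U R (Y a))))
          linarith
      _ ≤ (1 + h * L) * ((1 + h * L) ^ k * (I + k * (L * V * h ^ 2))) +
          (1 + h * L) ^ (k + 1) * (δ + L * V * h ^ 2) := by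
          refine add_le_add (mul_le_mul_of_nonneg_left ih (by positivity)) ?_
          exact le_mul_of_one_le_left hrest hone
      _ = _ := by ring

/-- The grid point lies to the right of `s` and tends to `s`, so right-continuity makes the
integrand eventually zero at each `s`. This is why the scheme reads the velocity at the right end of
a step. -/
theorem tendsto_integral_gridError {η : ℝ → Fin 2} (hη : RightContPath η) {t : ℝ} (ht : 0 < t) :
    Tendsto (fun n : ℕ => ∫ s in (0 : ℝ)..t, gridError c η (t / (n + 1)) s) atTop (𝓝 0) := by
  have : Tendsto (fun n : ℕ => ∫ s in (0 : ℝ)..t, gridError c η (t / (n + 1)) s) atTop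
      (𝓝 (∫ _ in (0 : ℝ)..t, (0 : ℝ))) := by
    refine intervalIntegral.tendsto_integral_filter_of_dominated_convergence
      (fun _ => 2 * (|c 0| + |c 1|)) ?_ ?_ intervalIntegrable_const ?_
    · exact Eventually.of_forall fun n => aestronglyMeasurable_gridError hη _ le_rfl ht.le
    · refine Eventually.of_forall fun n => Eventually.of_forall fun s _ => ?_
      rw [Real.norm_eq_abs, abs_of_nonneg (gridError_nonneg _ _ _)]
      exact gridError_le _ _ _
    · refine Eventually.of_forall fun s hs => ?_
      rw [uIoc_of_le ht.le] at hs
      have := ((hη.tendsto_comp_grid c hs.1.le ht).const_sub (c (η s))).abs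
      simpa [gridError] using this
  simpa using this

/-- With `n + 1` steps of length `t / (n + 1)` the growth factor stays below `exp (t * L)` and the
drift errors add up to `L * V * t ^ 2 / (n + 1)`. -/
theorem tendsto_eulerPath {η : ℝ → Fin 2} {x : ℝ} {Y : ℝ → ℝ}
    (hU : ContDiff ℝ 1 (deriv U)) (hη : RightContPath η)
    (hY : SolvesTelegraphEquation U c η x Y) {t : ℝ} (ht : 0 < t)
    (hYR : ∀ s ∈ Icc 0 t, |Y s| ≤ R) :
    Tendsto (fun n : ℕ => eulerPath U c R (t / (n + 1)) η x (n + 1)) atTop (𝓝 (Y t)) := by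
  have hR : 0 ≤ R := (abs_nonneg _).trans (hYR 0 ⟨le_rfl, ht.le⟩)
  obtain ⟨L, V, hL0, hV0, hL, hV⟩ := exists_clampedDrift_bounds hU c hR
  rw [tendsto_iff_norm_sub_tendsto_zero]
  have hlim : Tendsto (fun n : ℕ => Real.exp (t * L) *
      ((∫ s in (0 : ℝ)..t, gridError c η (t / (n + 1)) s) +
        L * V * t ^ 2 * (1 / ((n : ℝ) + 1)))) atTop (𝓝 (Real.exp (t * L) *
          (0 + L * V * t ^ 2 * 0))) :=
    ((tendsto_integral_gridError hη ht).add
      (tendsto_one_div_add_atTop_nhds_zero_nat.const_mul _)).const_mul _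
  simp only [mul_zero, add_zero] at hlim
  refine squeeze_zero (fun _ => norm_nonneg _) (fun n => ?_) hlim
  have hn : (0 : ℝ) < n + 1 := by positivity
  have hnt : ((n + 1 : ℕ) : ℝ) * (t / (n + 1)) = t := by push_cast; field_simp
  have h := abs_eulerPath_sub_solution_le hU hη hY hL0 hV0 hL hV hYR (h := t / (n + 1))
    (by positivity) (n + 1) hnt.le
  rw [hnt] at h
  refine h.trans (mul_le_mul ?_ (le_of_eq ?_) ?_ (Real.exp_pos _).le)
  · have h1 : 1 + t / (n + 1) * L ≤ Real.exp (t / (n + 1) * L) := by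
      linarith [Real.add_one_le_exp (t / (n + 1) * L)]
    refine (pow_le_pow_left₀ (by positivity) h1 _).trans_eq ?_
    rw [← Real.exp_nat_mul, ← mul_assoc, hnt]
  · push_cast; field_simp
  · have := intervalIntegral.integral_nonneg (μ := volume) ht.le
      fun s _ => gridError_nonneg (c := c) η (t / (n + 1)) s
    positivity

end Euler

/-! ### The switching process -/

theorem stronglyMeasurable_of_measurable {Ω : Type*} {m : MeasurableSpace Ω} {G : Ω → ℝ}
    (hG : Measurable[m] G) : StronglyMeasurable[m] G :=
  hG.stronglyMeasurable

theorem measurable_indicator_one {Ω : Type*} {m : MeasurableSpace Ω} {A : Set Ω}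
    (hA : MeasurableSet[m] A) : Measurable[m] (indicator A (1 : Ω → ℝ)) :=
  measurable_one.indicator hA

section History

variable {Ω E : Type*} [MeasurableSpace E] {Y : ℝ → Ω → E}

theorem measurable_history {s t : ℝ} (hs : 0 ≤ s) (hst : s ≤ t) :
    Measurable[history Y t] (Y s) := by
  rw [measurable_iff_comap_le]
  exact le_iSup₂_of_le s (⟨hs, hst⟩ : s ∈ Icc 0 t) le_rfl

theorem history_mono {s t : ℝ} (hst : s ≤ t) : history Y s ≤ history Y t :=
  iSup₂_le fun u hu => le_iSup₂_of_le u (⟨hu.1, hu.2.trans hst⟩ : u ∈ Icc 0 t) le_rfl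

theorem history_le [m : MeasurableSpace Ω] (hY : ∀ t, 0 ≤ t → Measurable (Y t)) (t : ℝ) :
    history Y t ≤ m :=
  iSup₂_le fun u hu => (hY u hu.1).comap_le

end History

namespace IsSwitchingProcess

variable {Ω : Type*} [MeasurableSpace Ω] {lam : Fin 2 → ℝ} {P : Fin 2 → Measure Ω}
  {ξ : ℝ → Ω → Fin 2}

theorem measurable (hξ : IsSwitchingProcess lam P ξ) {t : ℝ} (ht : 0 ≤ t) : Measurable (ξ t) :=
  hξ.markov.measurable 0 t ht

theorem isProbabilityMeasure (hξ : IsSwitchingProcess lam P ξ) (i : Fin 2) :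
    IsProbabilityMeasure (P i) :=
  hξ.markov.prob i

theorem rightContPath (hξ : IsSwitchingProcess lam P ξ) (ω : Ω) :
    RightContPath (fun s => ξ s ω) :=
  hξ.rightCont ω

theorem history_le (hξ : IsSwitchingProcess lam P ξ) (t : ℝ) : history ξ t ≤ ‹_› :=
  _root_.history_le (fun _ h => hξ.measurable h) t

theorem measurableSet_eq (hξ : IsSwitchingProcess lam P ξ) {t : ℝ} (ht : 0 ≤ t) (j : Fin 2) :
    MeasurableSet {ω | ξ t ω = j} :=
  hξ.measurable ht (measurableSet_singleton j)

theorem transitionLaw_singleton (hξ : IsSwitchingProcess lam P ξ) {t : ℝ} (ht : 0 ≤ t)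
    (k j : Fin 2) : transitionLaw P (fun _ => ξ) t k {j} = P k {ω | ξ t ω = j} := by
  rw [transitionLaw, Measure.map_apply (hξ.measurable ht) (measurableSet_singleton j)]
  rfl

/-- The Markov property, for functions of the past and of the present state. -/
theorem integral_markov (hξ : IsSwitchingProcess lam P ξ) {s t : ℝ} (hs : 0 ≤ s) (ht : 0 ≤ t)
    (i : Fin 2) {G : Fin 2 → Ω → ℝ} (hG : ∀ j, Measurable[history ξ s] (G j)) {M : ℝ}
    (hM : ∀ j ω, |G j ω| ≤ M) :
    ∫ ω, G (ξ (s + t) ω) ω ∂P i =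
      ∫ ω, ∑ j, (P (ξ s ω)).real {ω' | ξ t ω' = j} * G j ω ∂P i := by
  have := hξ.isProbabilityMeasure
  have hle := hξ.history_le s
  have hst : 0 ≤ s + t := add_nonneg hs ht
  have hGs : ∀ j, StronglyMeasurable[history ξ s] (G j) := fun j =>
    stronglyMeasurable_of_measurable (hG j)
  have hGm : ∀ j, Measurable (G j) := fun j => (hG j).mono hle le_rfl
  have hGi : ∀ j, Integrable (G j) (P i) := fun j =>
    Integrable.of_bound (hGm j).aestronglyMeasurable M (Eventually.of_forall (hM j))
  have hdm : ∀ j, Measurable fun ω => P (ξ s ω) {ω' | ξ t ω' = j} := fun j =>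
    (measurable_of_countable (fun k => P k {ω' | ξ t ω' = j})).comp (hξ.measurable hs)
  have key : ∀ j, ∫ ω in {ω | ξ (s + t) ω = j}, G j ω ∂P i =
      ∫ ω, (P (ξ s ω)).real {ω' | ξ t ω' = j} * G j ω ∂P i := by
    intro j
    -- Restricted to the past, the measure on the event `ξ (s + t) = j` has the density `P (ξ s) {ξ
    -- t = j}`. This is the Markov property itself, and it may be integrated against `G j` because
    -- `G j` depends on the past only.
    have htrim : ((P i).restrict {ω | ξ (s + t) ω = j}).trim hle =
        ((P i).withDensity fun ω => P (ξ s ω) {ω' | ξ t ω' = j}).trim hle := by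
      refine @Measure.ext _ (history ξ s) _ _ fun A hA => ?_
      have hA' := hle _ hA
      rw [trim_measurableSet_eq hle hA, trim_measurableSet_eq hle hA,
        Measure.restrict_apply hA', withDensity_apply _ hA']
      have := hξ.markov.markov i s t hs ht A hA {j} (measurableSet_singleton j)
      simp only [hξ.transitionLaw_singleton ht] at this
      exact this
    rw [integral_trim hle (hGs j), htrim,
      ← integral_trim hle (hGs j),
      integral_withDensity_eq_integral_toReal_smul (hdm j)
        (Eventually.of_forall fun ω => measure_lt_top _ _)]
    simp [measureReal_def]
  rw [integral_finsetSum]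
  · simp_rw [← key, ← integral_indicator (hξ.measurableSet_eq hst _)]
    rw [← integral_finsetSum]
    · refine integral_congr_ae (Eventually.of_forall fun ω => ?_)
      simp [indicator_apply]
    · exact fun j _ => (hGi j).indicator (hξ.measurableSet_eq hst _)
  · intro j _
    refine (hGi j).bdd_mul (c := 1) ?_ (Eventually.of_forall fun ω => ?_)
    · exact (hdm j).ennreal_toReal.aestronglyMeasurable
    · rw [Real.norm_eq_abs, abs_of_nonneg measureReal_nonneg]
      exact measureReal_le_one

/-- The probability of not being in the initial state tends to `0` at time `0`. -/
theorem tendsto_measureReal_ne (hξ : IsSwitchingProcess lam P ξ) (i : Fin 2) :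
    Tendsto (fun t : ℝ => (P i).real {ω | ξ t ω ≠ i}) (𝓝[>] 0) (𝓝 0) := by
  have h := (hξ.intensity i).mul
    (tendsto_nhdsWithin_of_tendsto_nhds (tendsto_id (α := ℝ) (x := 𝓝 0)) (s := Ioi 0))
  rw [mul_zero] at h
  refine h.congr' ?_
  filter_upwards [self_mem_nhdsWithin] with t ht
  have : t ≠ 0 := (mem_Ioi.1 ht).ne'
  simp only [id]
  field_simp

/-- Conditioning at time `s` leaves the probability of being elsewhere after time `t`. Summing over
the unknown state `ξ s` gives a bound free of `s`, as needed for stochastic continuity from both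
sides. -/
theorem measureReal_ne_le (hξ : IsSwitchingProcess lam P ξ) {s t : ℝ} (hs : 0 ≤ s) (ht : 0 ≤ t)
    (i : Fin 2) :
    (P i).real {ω | ξ (s + t) ω ≠ ξ s ω} ≤ ∑ k, (P k).real {ω | ξ t ω ≠ k} := by
  have := hξ.isProbabilityMeasure
  have hm : ∀ j, MeasurableSet[history ξ s] {ω | j ≠ ξ s ω} := fun j => by
    have : {ω | j ≠ ξ s ω} = ξ s ⁻¹' {j}ᶜ := by ext; simp [eq_comm]
    rw [this]
    exact measurable_history hs le_rfl (measurableSet_singleton j).compl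
  have h := hξ.integral_markov hs ht i (G := fun j => indicator {ω | j ≠ ξ s ω} 1) (M := 1)
    (fun j => measurable_indicator_one (hm j)) (fun j ω => by
      simp only [indicator_apply]; split_ifs <;> simp)
  have hms : MeasurableSet {ω | ξ (s + t) ω ≠ ξ s ω} :=
    (measurableSet_eq_fun (hξ.measurable (add_nonneg hs ht)) (hξ.measurable hs)).compl
  have e : (P i).real {ω | ξ (s + t) ω ≠ ξ s ω} =
      ∫ ω, indicator {ω' | ξ (s + t) ω ≠ ξ s ω'} 1 ω ∂P i := by
    rw [← integral_indicator_one hms]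
    exact integral_congr_ae (Eventually.of_forall fun ω => by simp [indicator_apply])
  rw [e, h]
  have hb : ∀ ω, ∑ j, (P (ξ s ω)).real {ω' | ξ t ω' = j} *
      indicator {ω | j ≠ ξ s ω} (1 : Ω → ℝ) ω ≤ ∑ k, (P k).real {ω | ξ t ω ≠ k} := by
    intro ω
    have hsub : ∀ k j : Fin 2, j ≠ k →
        (P k).real {ω' | ξ t ω' = j} ≤ (P k).real {ω' | ξ t ω' ≠ k} := fun k j hjk =>
      measureReal_mono (fun ω' (h : ξ t ω' = j) => by simpa [h] using hjk)
    simp only [indicator_apply, mem_ofPred_eq, Pi.one_apply]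
    generalize ξ s ω = k
    have hn : ∀ k, 0 ≤ (P k).real {ω' | ξ t ω' ≠ k} := fun k => measureReal_nonneg
    have h0 := hn 0
    have h1 := hn 1
    have h2 := hsub 0 1 (by decide)
    have h3 := hsub 1 0 (by decide)
    rw [Fin.sum_univ_two, Fin.sum_univ_two]
    fin_cases k
    · simpa using h2.trans (le_add_of_nonneg_right h1)
    · simpa using h3.trans (le_add_of_nonneg_left h0)
  refine (integral_mono_of_nonneg (Eventually.of_forall fun ω => ?_)
    (integrable_const (∑ k, (P k).real {ω | ξ t ω ≠ k})) (Eventually.of_forall hb)).trans_eq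
    (by simp)
  exact Finset.sum_nonneg fun j _ => mul_nonneg measureReal_nonneg
    (by simp only [indicator_apply]; split_ifs <;> simp)

/-- By the Markov property each further grid point contributes the same factor. The exponent is `m`
although there are `m + 1` points, since the state at time `0` is almost surely `i`. -/
theorem measure_forall_grid_eq (hξ : IsSwitchingProcess lam P ξ) (i : Fin 2) {h : ℝ} (hh : 0 ≤ h)
    (m : ℕ) : P i {ω | ∀ k : ℕ, k ≤ m → ξ (k * h) ω = i} = P i {ω | ξ h ω = i} ^ m := by
  have := hξ.isProbabilityMeasure
  induction m with
  | zero =>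
    have : ∀ᵐ ω ∂P i, ω ∈ {ω | ∀ k : ℕ, k ≤ 0 → ξ (k * h) ω = i} := by
      filter_upwards [hξ.markov.start i] with ω hω k hk
      simpa [Nat.le_zero.1 hk] using hω
    rw [pow_zero, ← prob_compl_eq_zero_iff₀]
    · exact this
    · exact (nullMeasurableSet_univ (μ := P i)).congr
        (by filter_upwards [this] with ω hω; exact propext ⟨fun _ => hω, fun _ => trivial⟩)
  | succ m ih =>
    have hA : MeasurableSet[history ξ (m * h)] {ω | ∀ k : ℕ, k ≤ m → ξ (k * h) ω = i} := by
      have : {ω | ∀ k : ℕ, k ≤ m → ξ (k * h) ω = i} =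
          ⋂ k : ℕ, ⋂ _ : k ≤ m, ξ (k * h) ⁻¹' {i} := by ext; simp
      rw [this]
      refine MeasurableSet.iInter fun k => MeasurableSet.iInter fun hk => ?_
      exact measurable_history (by positivity)
        (mul_le_mul_of_nonneg_right (by exact_mod_cast hk) hh) (measurableSet_singleton i)
    have e := hξ.markov.markov i (m * h) h (by positivity) hh _ hA {i} (measurableSet_singleton i)
    simp only [hξ.transitionLaw_singleton hh] at e
    have e2 : ({ω | ∀ k : ℕ, k ≤ m → ξ (k * h) ω = i} ∩ ξ (m * h + h) ⁻¹' {i}) =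
        {ω | ∀ k : ℕ, k ≤ m + 1 → ξ (k * h) ω = i} := by
      ext ω
      simp only [mem_inter_iff, mem_ofPred_eq, mem_preimage, mem_singleton_iff]
      have e3 : (m : ℝ) * h + h = ((m + 1 : ℕ) : ℝ) * h := by push_cast; ring
      rw [e3]
      constructor
      · rintro ⟨h1, h2⟩ k hk
        rcases Nat.le_succ_iff.1 hk with h | h
        · exact h1 k h
        · rw [h]; exact h2
      · exact fun H => ⟨fun k hk => H k (by omega), H _ le_rfl⟩
    rw [← e2, e, pow_succ, ← ih,
      setLIntegral_congr_fun (g := fun _ => P i {ω | ξ h ω = i}) (hξ.history_le _ _ hA)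
        (fun ω hω => by simp only [hω m le_rfl]), setLIntegral_const, mul_comm]

/-- With positive probability, hence for at least one path, there is no switch before `T`. -/
theorem exists_forall_eq (hξ : IsSwitchingProcess lam P ξ) (i : Fin 2) {T : ℝ} (hT : 0 < T) :
    ∃ ω, ∀ s ∈ Ico 0 T, ξ s ω = i := by
  have := hξ.isProbabilityMeasure
  -- The dyadic grids are nested, so these events decrease.
  let A : ℕ → Set Ω := fun n => {ω | ∀ k : ℕ, k ≤ 2 ^ n → ξ (k * (T / 2 ^ n)) ω = i}
  have hAm : ∀ n, MeasurableSet (A n) := fun n => by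
    have : A n = ⋂ k : ℕ, ⋂ _ : k ≤ 2 ^ n, {ω | ξ (k * (T / 2 ^ n)) ω = i} := by ext; simp [A]
    rw [this]
    exact MeasurableSet.iInter fun k => MeasurableSet.iInter fun _ =>
      hξ.measurableSet_eq (by positivity) i
  have hanti : Antitone A := antitone_nat_of_succ_le fun n ω hω k hk => by
    have := hω (2 * k) (by rw [pow_succ]; omega)
    have e : ((2 * k : ℕ) : ℝ) * (T / 2 ^ (n + 1)) = k * (T / 2 ^ n) := by
      push_cast; rw [pow_succ]; field_simp
    rwa [e] at this
  have hlim : Tendsto (fun n : ℕ => ((P i).real {ω | ξ (T / n) ω = i}) ^ n) atTop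
      (𝓝 (Real.exp (-(lam i * T)))) := by
    -- The intensity gives `n * P(ξ(T/n) ≠ i) → lam i * T`, and `(1 + a_n / n) ^ n` tends to the
    -- exponential of the limit of `a_n`.
    have h0 : Tendsto (fun n : ℕ => (n : ℝ) * -(P i).real {ω | ξ (T / n) ω ≠ i}) atTop
        (𝓝 (-(lam i * T))) := by
      have h1 : Tendsto (fun n : ℕ => T / (n : ℝ)) atTop (𝓝[>] 0) := by
        rw [tendsto_nhdsWithin_iff]
        refine ⟨tendsto_const_div_atTop_nhds_zero_nat T, ?_⟩
        filter_upwards [eventually_gt_atTop 0] with n hn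
        have : (0 : ℝ) < n := by exact_mod_cast hn
        exact mem_Ioi.2 (by positivity)
      have h2 := (((hξ.intensity i).comp h1).mul_const T).neg
      refine h2.congr' ?_
      filter_upwards [eventually_gt_atTop 0] with n hn
      have : (0 : ℝ) < n := by exact_mod_cast hn
      simp only [Function.comp]
      field_simp
    refine (Real.tendsto_one_add_pow_exp_of_tendsto h0).congr fun n => ?_
    have : (P i).real {ω | ξ (T / n) ω = i} = 1 - (P i).real {ω | ξ (T / n) ω ≠ i} := by
      have := probReal_compl_eq_one_sub (μ := P i)
        (hξ.measurableSet_eq (t := T / n) (by positivity) i)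
      have e : {ω | ξ (T / n) ω = i}ᶜ = {ω | ξ (T / n) ω ≠ i} := rfl
      rw [e] at this
      linarith
    rw [this, sub_eq_add_neg]
  have hlim2 : Tendsto (fun n => (P i).real (A n)) atTop (𝓝 (Real.exp (-(lam i * T)))) := by
    refine (hlim.comp (tendsto_pow_atTop_atTop_of_one_lt (one_lt_two (α := ℕ)))).congr fun n => ?_
    have := hξ.measure_forall_grid_eq i (h := T / 2 ^ n) (by positivity) (2 ^ n)
    simp only [Function.comp, A, measureReal_def, this, ENNReal.toReal_pow]
    push_cast
    rfl
  -- An empty intersection would force the probabilities to tend to `0` instead of `exp (-(lam i *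
  -- T))`.
  have hne : (⋂ n, A n).Nonempty := by
    by_contra hemp
    rw [not_nonempty_iff_eq_empty] at hemp
    have h := tendsto_measure_iInter_atTop (μ := P i) (fun n => (hAm n).nullMeasurableSet) hanti
      ⟨0, measure_ne_top _ _⟩
    rw [hemp, measure_empty] at h
    have h2 := (ENNReal.tendsto_toReal ENNReal.zero_ne_top).comp h
    have := tendsto_nhds_unique h2 hlim2
    exact (Real.exp_pos _).ne this
  obtain ⟨ω, hω⟩ := hne
  rw [mem_iInter] at hω
  refine ⟨ω, fun s hs => ?_⟩
  -- `tendsto_grid` divides `T` by `n + 1`, so `n = 2 ^ m - 1` gives the dyadic grids. By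
  -- right-continuity `ξ s` equals the value at the next dyadic point, which is at most `T` because
  -- `s < T`.
  have h1 : Tendsto (fun m : ℕ => 2 ^ m - 1) atTop atTop :=
    (tendsto_sub_atTop_nat 1).comp (tendsto_pow_atTop_atTop_of_one_lt (one_lt_two (α := ℕ)))
  have h2 := ((RightContPath.tendsto_grid (s := s) hT).comp h1).eventually
    ((hξ.rightContPath ω).eventually_eq hs.1)
  obtain ⟨m, hm⟩ := h2.exists
  have hcast : ((2 ^ m - 1 : ℕ) : ℝ) + 1 = 2 ^ m := by
    rw [Nat.cast_sub Nat.one_le_two_pow]; push_cast; ring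
  rw [Function.comp, hcast] at hm
  rw [← hm]
  have hpos : 0 < T / 2 ^ m := by positivity
  have hfl : 0 ≤ ⌊s / (T / 2 ^ m)⌋ := Int.floor_nonneg.2 (div_nonneg hs.1 hpos.le)
  obtain ⟨k, hk⟩ := Int.eq_ofNat_of_zero_le hfl
  have := hω m (k + 1) (by
    have h3 : ⌊s / (T / 2 ^ m)⌋ < 2 ^ m := by
      rw [Int.floor_lt, div_lt_iff₀ hpos]
      push_cast
      rw [mul_div_cancel₀ _ (by positivity)]
      exact hs.2
    rw [hk] at h3
    exact_mod_cast h3)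
  rw [hk]
  push_cast at this ⊢
  exact this

end IsSwitchingProcess

/-! ### The solutions as functions of the starting point -/

/-- The solutions of the telegraph equation along the paths of a switching process, for all
starting points. -/
structure IsTelegraphFlow {Ω : Type*} [MeasurableSpace Ω] (U : ℝ → ℝ) (c lam : Fin 2 → ℝ)
    (P : Fin 2 → Measure Ω) (ξ : ℝ → Ω → Fin 2) (X : ℝ → ℝ → Ω → ℝ) : Prop where
  contDiff : ContDiff ℝ 1 (deriv U)
  le : c 1 ≤ c 0
  switching : IsSwitchingProcess lam P ξ
  measurable : ∀ x t, 0 ≤ t → Measurable (X x t)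
  solves : ∀ x ω, SolvesTelegraphEquation U c (fun s => ξ s ω) x (fun s => X x s ω)

namespace IsTelegraphFlow

theorem measurable_comp_pair {Ω : Type*} {m : MeasurableSpace Ω} {f : ℝ → Fin 2 → ℝ}
    (hf : ∀ j, Continuous fun x => f x j) {Z : Ω → ℝ} {η : Ω → Fin 2} (hZ : Measurable[m] Z)
    (hη : Measurable[m] η) : Measurable[m] fun ω => f (Z ω) (η ω) :=
  (measurable_from_prod_countable_left (f := fun p : ℝ × Fin 2 => f p.1 p.2)
    fun j => (hf j).measurable).comp (hZ.prodMk hη)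

/-- The first `k` steps read `ξ` only at the times `s + τ, …, s + k * τ`. -/
theorem measurable_eulerPath {Ω : Type*} {U : ℝ → ℝ} {c : Fin 2 → ℝ} {R : ℝ} {ξ : ℝ → Ω → Fin 2}
    (hU : Continuous (deriv U)) {s τ : ℝ} (hs : 0 ≤ s) (hτ : 0 ≤ τ) {Z : Ω → ℝ}
    (hZ : Measurable[history ξ s] Z) (k : ℕ) :
    Measurable[history ξ (s + k * τ)]
      fun ω => eulerPath U c R τ (fun u => ξ (s + u) ω) (Z ω) k := by
  induction k with
  | zero =>
    rw [Nat.cast_zero, zero_mul, add_zero]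
    exact hZ
  | succ k ih =>
    have e : ((k + 1 : ℕ) : ℝ) = k + 1 := by push_cast; rfl
    rw [e]
    have hle : s + k * τ ≤ s + (k + 1) * τ := by nlinarith
    have h1 : Measurable[history ξ (s + (k + 1) * τ)]
        fun ω => eulerPath U c R τ (fun u => ξ (s + u) ω) (Z ω) k :=
      ih.mono (history_mono hle) le_rfl
    have h2 : Measurable[history ξ (s + (k + 1) * τ)] (ξ (s + (k + 1) * τ)) :=
      _root_.measurable_history (by positivity) le_rfl
    exact measurable_comp_pair (continuous_eulerStep (c := c) (R := R) hU τ) h1 h2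

section FlowSlope

variable {Ω : Type*} {U : ℝ → ℝ} {X : ℝ → ℝ → Ω → ℝ}

/-- The difference quotient of the solution with respect to the starting point. -/
noncomputable def flowSlope (U : ℝ → ℝ) (X : ℝ → ℝ → Ω → ℝ) (ω : Ω) (x y t : ℝ) : ℝ :=
  Real.exp (-∫ s in (0 : ℝ)..t,
    avgDeriv (deriv U) (X x (max s 0) ω) (X y (max s 0) ω))

theorem gapExponent_eq (x y : ℝ) (ω : Ω) {t : ℝ} (ht : 0 ≤ t) :
    SolvesTelegraphEquation.gapExponent U (fun s => X x s ω) (fun s => X y s ω) t =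
      ∫ s in (0 : ℝ)..t, avgDeriv (deriv U) (X x (max s 0) ω) (X y (max s 0) ω) := by
  refine intervalIntegral.integral_congr fun s hs => ?_
  rw [uIcc_of_le ht] at hs
  simp [max_eq_left hs.1]

theorem flowSlope_pos (ω : Ω) (x y t : ℝ) : 0 < flowSlope U X ω x y t := Real.exp_pos _

end FlowSlope

variable {Ω : Type*} [MeasurableSpace Ω] {U : ℝ → ℝ} {c lam : Fin 2 → ℝ}
  {P : Fin 2 → Measure Ω} {ξ : ℝ → Ω → Fin 2} {X : ℝ → ℝ → Ω → ℝ}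

theorem apply_zero (h : IsTelegraphFlow U c lam P ξ X) (x : ℝ) (ω : Ω) : X x 0 ω = x :=
  (h.solves x ω).apply_zero

theorem rightContPath (h : IsTelegraphFlow U c lam P ξ X) (ω : Ω) :
    RightContPath (fun s => ξ s ω) :=
  h.switching.rightContPath ω

theorem isProbabilityMeasure (h : IsTelegraphFlow U c lam P ξ X) (i : Fin 2) :
    IsProbabilityMeasure (P i) :=
  h.switching.isProbabilityMeasure i

/-- On bounded time intervals the solutions are bounded, uniformly in the path. -/
theorem exists_bound (h : IsTelegraphFlow U c lam P ξ X) (r T : ℝ) :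
    ∃ R, 0 ≤ R ∧ ∀ x, |x| ≤ r → ∀ s ∈ Icc 0 T, ∀ ω, |X x s ω| ≤ R := by
  have hT : 0 < max T 0 + 1 := by positivity
  -- Since `c 1 ≤ c 0`, the solution from `r` along a path that stays in state `0` lies above all
  -- others, and the solution from `-r` along a path that stays in state `1` lies below them.
  obtain ⟨ω₀, h₀⟩ := h.switching.exists_forall_eq 0 hT
  obtain ⟨ω₁, h₁⟩ := h.switching.exists_forall_eq 1 hT
  have hsub : Icc 0 T ⊆ Ici 0 := Icc_subset_Ici_self
  obtain ⟨R₀, hR₀⟩ := isCompact_Icc.exists_bound_of_continuousOn ((h.solves r ω₀).cont.mono hsub)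
  obtain ⟨R₁, hR₁⟩ :=
    isCompact_Icc.exists_bound_of_continuousOn ((h.solves (-r) ω₁).cont.mono hsub)
  refine ⟨max 0 (max R₀ R₁), le_max_left _ _, fun x hx s hs ω => ?_⟩
  rw [abs_le] at hx
  have hlt : ∀ u ∈ Ico 0 s, u ∈ Ico 0 (max T 0 + 1) := fun u hu =>
    ⟨hu.1, by linarith [hu.2, hs.2, le_max_left T 0]⟩
  have hcle : ∀ i, c 1 ≤ c i ∧ c i ≤ c 0 := fun i => by fin_cases i <;> simp [h.le]
  have up : X x s ω ≤ X r s ω₀ :=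
    SolvesTelegraphEquation.le_of_le h.contDiff (h.rightContPath ω) (h.rightContPath ω₀) hx.2
      (h.solves x ω) (h.solves r ω₀) hs.1
      (fun u hu => by simpa [h₀ u (hlt u hu)] using (hcle (ξ u ω)).2)
  have lo : X (-r) s ω₁ ≤ X x s ω :=
    SolvesTelegraphEquation.le_of_le h.contDiff (h.rightContPath ω₁) (h.rightContPath ω) hx.1
      (h.solves (-r) ω₁) (h.solves x ω) hs.1
      (fun u hu => by simpa [h₁ u (hlt u hu)] using (hcle (ξ u ω)).1)
  have a := abs_le.1 (hR₀ s hs)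
  have b := abs_le.1 (hR₁ s hs)
  have m1 := le_max_left R₀ R₁
  have m2 := le_max_right R₀ R₁
  have m3 := le_max_right 0 (max R₀ R₁)
  rw [abs_le]
  constructor <;> linarith [a.1, a.2, b.1, b.2]

/-- A continuous function is bounded along the solutions. -/
theorem exists_bound_comp (h : IsTelegraphFlow U c lam P ξ X) {g : ℝ → ℝ} (hg : Continuous g)
    (r T : ℝ) : ∃ M, 0 ≤ M ∧ ∀ x, |x| ≤ r → ∀ s ∈ Icc 0 T, ∀ ω, |g (X x s ω)| ≤ M := by
  obtain ⟨R, hR0, hR⟩ := h.exists_bound r T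
  obtain ⟨M, hM⟩ := isCompact_Icc.exists_bound_of_continuousOn (s := Icc (-R) R) hg.continuousOn
  exact ⟨M, (norm_nonneg _).trans (hM 0 ⟨by linarith, hR0⟩),
    fun x hx s hs ω => hM _ (abs_le.1 (hR x hx s hs ω))⟩

/-- The bound for finitely many continuous functions. -/
theorem exists_bound_family (h : IsTelegraphFlow U c lam P ξ X) {f : ℝ → Fin 2 → ℝ}
    (hf : ∀ j, Continuous fun x => f x j) (r T : ℝ) :
    ∃ M, 0 ≤ M ∧ ∀ x, |x| ≤ r → ∀ s ∈ Icc 0 T, ∀ ω j, |f (X x s ω) j| ≤ M := by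
  choose M hM0 hM using fun j => h.exists_bound_comp (hf j) r T
  refine ⟨M 0 + M 1, add_nonneg (hM0 0) (hM0 1), fun x hx s hs ω j => (hM j x hx s hs ω).trans ?_⟩
  have h0 := hM0 0
  have h1 := hM0 1
  fin_cases j <;> simp [h0, h1]

theorem sub_eq (h : IsTelegraphFlow U c lam P ξ X) (x y : ℝ) (ω : Ω) {t : ℝ} (ht : 0 ≤ t) :
    X y t ω - X x t ω = (y - x) * flowSlope U X ω x y t := by
  rw [flowSlope, ← gapExponent_eq x y ω ht]
  exact SolvesTelegraphEquation.gap_eq h.contDiff (h.rightContPath ω) (h.solves x ω)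
    (h.solves y ω) ht

theorem exists_flowSlope_bound (h : IsTelegraphFlow U c lam P ξ X) (r T : ℝ) :
    ∃ K, 0 ≤ K ∧ ∀ x y, |x| ≤ r → |y| ≤ r → ∀ s ∈ Icc 0 T, ∀ ω, flowSlope U X ω x y s ≤ K := by
  obtain ⟨R, hR0, hR⟩ := h.exists_bound r T
  obtain ⟨L, hL⟩ := (isCompact_Icc.prod isCompact_Icc).exists_bound_of_continuousOn
    (s := Icc (-R) R ×ˢ Icc (-R) R) (continuous_avgDeriv h.contDiff).continuousOn
  have hL0 : 0 ≤ L := (norm_nonneg _).trans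
    (hL (0, 0) ⟨⟨by simpa, hR0⟩, ⟨by simpa, hR0⟩⟩)
  refine ⟨Real.exp (L * T), (Real.exp_pos _).le, fun x y hx hy s hs ω => ?_⟩
  refine Real.exp_le_exp.2 ?_
  have := intervalIntegral.norm_integral_le_of_norm_le_const (a := 0) (b := s) (C := L)
    (f := fun s => avgDeriv (deriv U) (X x (max s 0) ω) (X y (max s 0) ω)) fun u hu => by
      rw [uIoc_of_le hs.1] at hu
      rw [max_eq_left hu.1.le]
      have hu' : u ∈ Icc 0 T := ⟨hu.1.le, hu.2.trans hs.2⟩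
      exact hL (_, _) ⟨abs_le.1 (hR x hx u hu' ω), abs_le.1 (hR y hy u hu' ω)⟩
  rw [sub_zero, abs_of_nonneg hs.1] at this
  exact (neg_le_abs _).trans (this.trans (mul_le_mul_of_nonneg_left hs.2 hL0))

/-- The solution depends continuously on the starting point and the time. -/
theorem continuous_uncurry (h : IsTelegraphFlow U c lam P ξ X) (ω : Ω) :
    Continuous fun p : ℝ × ℝ => X p.1 (max p.2 0) ω := by
  rw [continuous_iff_continuousAt]
  rintro ⟨x, t⟩
  obtain ⟨K, hK0, hK⟩ := h.exists_flowSlope_bound (|x| + 1) (|t| + 1)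
  have h1 : Tendsto (fun p : ℝ × ℝ => X x (max p.2 0) ω) (𝓝 (x, t)) (𝓝 (X x (max t 0) ω)) :=
    ((h.solves x ω).continuous_max.comp continuous_snd).tendsto (x, t)
  have h2 : Tendsto (fun p : ℝ × ℝ => X p.1 (max p.2 0) ω - X x (max p.2 0) ω) (𝓝 (x, t))
      (𝓝 0) := by
    have h3 : Tendsto (fun p : ℝ × ℝ => |p.1 - x| * K) (𝓝 (x, t)) (𝓝 0) := by
      have : Continuous fun p : ℝ × ℝ => |p.1 - x| * K := by fun_prop
      simpa using this.tendsto (x, t)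
    refine squeeze_zero_norm' ?_ h3
    have e1 : ∀ᶠ p : ℝ × ℝ in 𝓝 (x, t), |p.1 - x| < 1 := by
      have : Continuous fun p : ℝ × ℝ => |p.1 - x| := by fun_prop
      exact this.tendsto (x, t) |>.eventually (gt_mem_nhds (by simp))
    have e2 : ∀ᶠ p : ℝ × ℝ in 𝓝 (x, t), p.2 < |t| + 1 := by
      have : Continuous fun p : ℝ × ℝ => p.2 := by fun_prop
      exact this.tendsto (x, t) |>.eventually (gt_mem_nhds (by
        have := le_abs_self t; simp only; linarith))
    filter_upwards [e1, e2] with p hp1 hp2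
    rw [h.sub_eq x p.1 ω (le_max_right _ _), norm_mul, Real.norm_eq_abs, Real.norm_eq_abs,
      abs_of_pos (flowSlope_pos _ _ _ _)]
    refine mul_le_mul_of_nonneg_left (hK x p.1 (by linarith) ?_ _ ?_ ω) (abs_nonneg _)
    · have := abs_sub_abs_le_abs_sub p.1 x
      linarith
    · exact ⟨le_max_right _ _, max_le hp2.le (by positivity)⟩
  simpa [ContinuousAt] using h2.add h1

theorem continuous_flowSlope (h : IsTelegraphFlow U c lam P ξ X) (ω : Ω) :
    Continuous fun p : (ℝ × ℝ) × ℝ => flowSlope U X ω p.1.1 p.1.2 p.2 := by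
  refine Real.continuous_exp.comp (Continuous.neg ?_)
  refine intervalIntegral.continuous_parametric_intervalIntegral_of_continuous
    (f := fun (p : (ℝ × ℝ) × ℝ) s =>
      avgDeriv (deriv U) (X p.1.1 (max s 0) ω) (X p.1.2 (max s 0) ω)) ?_ continuous_snd
  have h1 := h.continuous_uncurry ω
  exact (continuous_avgDeriv h.contDiff).comp
    ((h1.comp (by fun_prop : Continuous fun q : ((ℝ × ℝ) × ℝ) × ℝ => (q.1.1.1, q.2))).prodMk
      (h1.comp (by fun_prop : Continuous fun q : ((ℝ × ℝ) × ℝ) × ℝ => (q.1.1.2, q.2))))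

/-- The difference quotient equals `flowSlope` exactly, and `flowSlope` is continuous up to the
diagonal, where the average of `U''` becomes `U''` along the solution. -/
theorem hasDerivAt_start (h : IsTelegraphFlow U c lam P ξ X) (ω : Ω) {t : ℝ} (ht : 0 ≤ t)
    (x : ℝ) : HasDerivAt (fun y => X y t ω) (flowSlope U X ω x x t) x := by
  rw [hasDerivAt_iff_tendsto_slope]
  have h1 : Tendsto (fun y => flowSlope U X ω x y t) (𝓝[≠] x) (𝓝 (flowSlope U X ω x x t)) :=
    (((h.continuous_flowSlope ω).comp
      (by fun_prop : Continuous fun y : ℝ => ((x, y), t))).tendsto x).mono_left nhdsWithin_le_nhds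
  refine h1.congr' ?_
  filter_upwards [self_mem_nhdsWithin] with y hy
  rw [slope_def_field, h.sub_eq x y ω ht, mul_div_cancel_left₀ _ (sub_ne_zero.2 hy)]

theorem continuous_start (h : IsTelegraphFlow U c lam P ξ X) (ω : Ω) {t : ℝ} (ht : 0 ≤ t) :
    Continuous fun y => X y t ω :=
  continuous_iff_continuousAt.2 fun x => (h.hasDerivAt_start ω ht x).continuousAt

/-- It is a pointwise limit of difference quotients of the measurable variables `X y t`. -/
theorem measurable_flowSlope_self (h : IsTelegraphFlow U c lam P ξ X) {t : ℝ} (ht : 0 ≤ t)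
    (x : ℝ) : Measurable fun ω => flowSlope U X ω x x t := by
  refine measurable_of_tendsto_metrizable
    (f := fun (n : ℕ) ω => (X (x + 1 / ((n : ℝ) + 1)) t ω - X x t ω) / (1 / ((n : ℝ) + 1)))
    (fun n => ((h.measurable _ t ht).sub (h.measurable _ t ht)).div_const _) ?_
  rw [tendsto_pi_nhds]
  intro ω
  have h1 : Tendsto (fun n : ℕ => x + 1 / ((n : ℝ) + 1)) atTop (𝓝 x) := by
    simpa using tendsto_one_div_add_atTop_nhds_zero_nat.const_add x
  refine ((((h.continuous_flowSlope ω).comp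
    (by fun_prop : Continuous fun y : ℝ => ((x, y), t))).tendsto x).comp h1).congr fun n => ?_
  have hn : (1 : ℝ) / ((n : ℝ) + 1) ≠ 0 := by positivity
  rw [h.sub_eq _ _ ω ht, add_sub_cancel_left, mul_div_cancel_left₀ _ hn]
  rfl

/-- The solution is adapted to the history of the switching process. -/
theorem measurable_history (h : IsTelegraphFlow U c lam P ξ X) (x : ℝ) {t : ℝ} (ht : 0 ≤ t) :
    Measurable[history ξ t] (X x t) := by
  rcases ht.eq_or_lt with rfl | ht
  · have : X x 0 = fun _ => x := funext fun ω => h.apply_zero x ω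
    rw [this]
    exact measurable_const
  obtain ⟨R, -, hR⟩ := h.exists_bound |x| t
  -- The Euler approximations read `ξ` at grid times up to `t` only, so their limit is determined by
  -- the history up to `t`.
  refine @measurable_of_tendsto_metrizable Ω ℝ (history ξ t) _ _ _ _
    (fun n ω => eulerPath U c R (t / (n + 1)) (fun s => ξ s ω) x (n + 1)) _ (fun n => ?_) ?_
  · have h1 := measurable_eulerPath (U := U) (c := c) (R := R) (ξ := ξ) (Z := fun _ => x)
      h.contDiff.continuous le_rfl (by positivity : 0 ≤ t / (n + 1)) measurable_const (n + 1)
    have e : (0 : ℝ) + ((n + 1 : ℕ) : ℝ) * (t / (n + 1)) = t := by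
      push_cast
      field_simp
      simp
    rw [e] at h1
    simpa only [zero_add] using h1
  · rw [tendsto_pi_nhds]
    exact fun ω => tendsto_eulerPath h.contDiff (h.rightContPath ω) (h.solves x ω) ht
      fun s hs => hR x le_rfl s hs ω

end IsTelegraphFlow

/-! ### The Markov property of the pair -/

/-- The transition operator of the Euler scheme. -/
noncomputable def eulerOp {Ω : Type*} [MeasurableSpace Ω] (U : ℝ → ℝ) (c : Fin 2 → ℝ) (R τ : ℝ)
    (P : Fin 2 → Measure Ω) (ξ : ℝ → Ω → Fin 2) (g : ℝ → Fin 2 → ℝ) : ℝ → Fin 2 → ℝ :=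
  fun z i => ∑ j, (P i).real {ω | ξ τ ω = j} * g (eulerStep U c R τ z j) j

namespace IsTelegraphFlow

variable {Ω : Type*} [MeasurableSpace Ω] {U : ℝ → ℝ} {c lam : Fin 2 → ℝ}
  {P : Fin 2 → Measure Ω} {ξ : ℝ → Ω → Fin 2} {X : ℝ → ℝ → Ω → ℝ}

theorem continuous_eulerOp (hU : Continuous (deriv U)) (R τ : ℝ) {g : ℝ → Fin 2 → ℝ}
    (hg : ∀ j, Continuous fun x => g x j) (i : Fin 2) :
    Continuous fun z => eulerOp U c R τ P ξ g z i := by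
  unfold eulerOp
  exact continuous_finsetSum _ fun j _ =>
    continuous_const.mul ((hg j).comp (continuous_eulerStep hU τ j))

theorem continuous_iterate_eulerOp (hU : Continuous (deriv U)) (R τ : ℝ) (n : ℕ)
    {g : ℝ → Fin 2 → ℝ} (hg : ∀ j, Continuous fun x => g x j) (i : Fin 2) :
    Continuous fun z => (eulerOp U c R τ P ξ)^[n] g z i := by
  induction n generalizing g with
  | zero => exact hg i
  | succ n ih => exact ih (continuous_eulerOp hU R τ hg)

theorem exists_bound_of_continuous {f : ℝ → Fin 2 → ℝ} (hf : ∀ j, Continuous fun x => f x j)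
    (r : ℝ) : ∃ M, ∀ x, |x| ≤ r → ∀ j, |f x j| ≤ M := by
  choose M hM using fun j => (isCompact_Icc (a := -r) (b := r)).exists_bound_of_continuousOn
    (hf j).continuousOn
  refine ⟨max (M 0) (M 1), fun x hx j => (hM j x (abs_le.1 hx)).trans ?_⟩
  fin_cases j <;> simp

/-- The last step is a function of the history up to `s + n * τ` and of the next state, so the
Markov property of `ξ` replaces `g` by `eulerOp g` and leaves `n` steps. -/
theorem integral_eulerPath (h : IsTelegraphFlow U c lam P ξ X) {R s τ : ℝ} (hR : 0 ≤ R)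
    (hs : 0 ≤ s) (hτ : 0 ≤ τ) (i : Fin 2) {H Z : Ω → ℝ} (hH : Measurable[history ξ s] H)
    {M r : ℝ} (hM : ∀ ω, |H ω| ≤ M) (hZ : Measurable[history ξ s] Z) (hr : ∀ ω, |Z ω| ≤ r)
    (n : ℕ) {g : ℝ → Fin 2 → ℝ} (hg : ∀ j, Continuous fun x => g x j) :
    ∫ ω, H ω * g (eulerPath U c R τ (fun u => ξ (s + u) ω) (Z ω) n) (ξ (s + n * τ) ω) ∂P i =
      ∫ ω, H ω * (eulerOp U c R τ P ξ)^[n] g (Z ω) (ξ s ω) ∂P i := by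
  induction n generalizing g with
  | zero => simp [eulerPath]
  | succ n ih =>
    obtain ⟨L, V, -, hV0, -, hV⟩ := exists_clampedDrift_bounds h.contDiff c hR
    have hsn : 0 ≤ s + n * τ := by positivity
    have hgE : ∀ j, Continuous fun z => g (eulerStep U c R τ z j) j := fun j =>
      (hg j).comp (continuous_eulerStep h.contDiff.continuous τ j)
    -- Started within `[-r, r]`, the scheme moves at most `V * (n * τ)` in `n` steps, so the
    -- continuous `g` is needed on a compact interval only.
    obtain ⟨B, hB⟩ := exists_bound_of_continuous hgE (r + V * (n * τ))
    have hE := measurable_eulerPath (U := U) (c := c) (R := R) h.contDiff.continuous hs hτ hZ n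
    have hH' : Measurable[history ξ (s + n * τ)] H :=
      hH.mono (history_mono (by nlinarith [mul_nonneg (Nat.cast_nonneg (α := ℝ) n) hτ])) le_rfl
    have key := h.switching.integral_markov hsn hτ i
      (G := fun j ω => H ω *
        g (eulerStep U c R τ (eulerPath U c R τ (fun u => ξ (s + u) ω) (Z ω) n) j) j)
      (M := M * B) (fun j => hH'.mul ((hgE j).measurable.comp hE)) (fun j ω => by
        rw [abs_mul]
        refine mul_le_mul (hM ω) (hB _ ?_ j) (abs_nonneg _) ((abs_nonneg _).trans (hM ω))
        have h1 := abs_eulerPath_sub_le hV hτ (fun u => ξ (s + u) ω) (Z ω) n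
        have h2 := abs_sub_abs_le_abs_sub
          (eulerPath U c R τ (fun u => ξ (s + u) ω) (Z ω) n) (Z ω)
        linarith [hr ω])
    have e : s + n * τ + τ = s + ((n + 1 : ℕ) : ℝ) * τ := by push_cast; ring
    have e' : s + n * τ + τ = s + ((n : ℝ) + 1) * τ := by ring
    rw [Function.iterate_succ_apply, ← ih (continuous_eulerOp h.contDiff.continuous R τ hg)]
    simp only [eulerPath, ← e, ← e']
    rw [key]
    refine integral_congr_ae (Eventually.of_forall fun ω => ?_)
    simp only [eulerOp, Finset.mul_sum]
    exact Finset.sum_congr rfl fun j _ => by ring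

theorem iterate_eulerOp_eq (h : IsTelegraphFlow U c lam P ξ X) {R τ : ℝ} (hR : 0 ≤ R)
    (hτ : 0 ≤ τ) (n : ℕ) {g : ℝ → Fin 2 → ℝ} (hg : ∀ j, Continuous fun x => g x j)
    (y : ℝ) (k : Fin 2) :
    (eulerOp U c R τ P ξ)^[n] g y k =
      ∫ ω, g (eulerPath U c R τ (fun u => ξ u ω) y n) (ξ (n * τ) ω) ∂P k := by
  have := h.isProbabilityMeasure
  have e := h.integral_eulerPath hR le_rfl hτ k (H := fun _ => 1) (Z := fun _ => y)
    measurable_const (M := 1) (fun _ => by simp) measurable_const (r := |y|) (fun _ => le_rfl) n hg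
  simp only [zero_add, one_mul] at e
  rw [e]
  have : ∀ᵐ ω ∂P k, (eulerOp U c R τ P ξ)^[n] g y (ξ 0 ω) = (eulerOp U c R τ P ξ)^[n] g y k := by
    filter_upwards [h.switching.markov.start k] with ω hω
    rw [hω]
  rw [integral_congr_ae this]
  simp

/-- The Markov property, for continuous functions. -/
theorem integral_markov (h : IsTelegraphFlow U c lam P ξ X) (x : ℝ) {s t : ℝ} (hs : 0 ≤ s)
    (ht : 0 ≤ t) (i : Fin 2) {H : Ω → ℝ} (hH : Measurable[history ξ s] H) {M : ℝ}
    (hM : ∀ ω, |H ω| ≤ M) {f : ℝ → Fin 2 → ℝ} (hf : ∀ j, Continuous fun x => f x j) :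
    ∫ ω, H ω * f (X x (s + t) ω) (ξ (s + t) ω) ∂P i =
      ∫ ω, H ω * (∫ ω', f (X (X x s ω) t ω') (ξ t ω') ∂P (ξ s ω)) ∂P i := by
  have hprob := h.isProbabilityMeasure
  rcases ht.eq_or_lt with rfl | ht
  · refine integral_congr_ae (Eventually.of_forall fun ω => ?_)
    have : ∀ᵐ ω' ∂P (ξ s ω), f (X (X x s ω) 0 ω') (ξ 0 ω') = f (X x s ω) (ξ s ω) := by
      filter_upwards [h.switching.markov.start (ξ s ω)] with ω' hω'
      rw [hω', h.apply_zero]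
    simp only [integral_congr_ae this]
    simp
  -- `R₀` encloses the solution from `x` up to time `s + t`, and `R₁` encloses the solutions
  -- restarted anywhere in `[-R₀, R₀]`. One clamp at the larger level serves both sides of the
  -- identity.
  obtain ⟨R₀, hR₀0, hR₀⟩ := h.exists_bound |x| (s + t)
  obtain ⟨R₁, hR₁0, hR₁⟩ := h.exists_bound R₀ t
  have hbd : ∀ ω, ∀ u ∈ Icc 0 (s + t), |X x u ω| ≤ R₀ := fun ω u hu => hR₀ x le_rfl u hu ω
  have hsm : s ∈ Icc 0 (s + t) := ⟨hs, by linarith⟩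
  have hR : 0 ≤ max R₀ R₁ := le_max_of_le_left hR₀0
  obtain ⟨L, V, -, hV0, -, hV⟩ := exists_clampedDrift_bounds h.contDiff c hR
  obtain ⟨B, hB⟩ := exists_bound_of_continuous hf (R₀ + V * t)
  have hle := h.switching.history_le s
  have hHm : Measurable H := hH.mono hle le_rfl
  have hst : 0 ≤ s + t := by positivity
  have hτ : ∀ n : ℕ, 0 ≤ t / ((n : ℝ) + 1) := fun n => by positivity
  have hnt : ∀ n : ℕ, ((n + 1 : ℕ) : ℝ) * (t / ((n : ℝ) + 1)) = t := fun n => by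
    push_cast; field_simp
  have hEbd : ∀ (η : ℝ → Fin 2) (y : ℝ), |y| ≤ R₀ → ∀ (n : ℕ) (j : Fin 2),
      |f (eulerPath U c (max R₀ R₁) (t / (n + 1)) η y (n + 1)) j| ≤ B := fun η y hy n j => by
    refine hB _ ?_ j
    have h1 := abs_eulerPath_sub_le hV (hτ n) η y (n + 1)
    rw [hnt] at h1
    have h2 := abs_sub_abs_le_abs_sub
      (eulerPath U c (max R₀ R₁) (t / (n + 1)) η y (n + 1)) y
    linarith
  have hZ := h.measurable_history x hs
  have hQ : ∀ y k, |y| ≤ R₀ → ∀ n : ℕ, (eulerOp U c (max R₀ R₁) (t / (n + 1)) P ξ)^[n + 1] f y k =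
      ∫ ω, f (eulerPath U c (max R₀ R₁) (t / (n + 1)) (fun u => ξ u ω) y (n + 1)) (ξ t ω) ∂P k :=
    fun y k hy n => by rw [h.iterate_eulerOp_eq hR (hτ n) (n + 1) hf, hnt]
  have hEm : ∀ n : ℕ, ∀ y, Measurable fun ω =>
      f (eulerPath U c (max R₀ R₁) (t / (n + 1)) (fun u => ξ u ω) y (n + 1)) (ξ t ω) := by
    intro n y
    have h1 := (measurable_eulerPath (U := U) (c := c) (R := max R₀ R₁) (ξ := ξ)
      (Z := fun _ => y) h.contDiff.continuous le_rfl (hτ n) measurable_const (n + 1)).mono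
      (h.switching.history_le _) le_rfl
    simp only [zero_add] at h1
    exact measurable_comp_pair hf h1 (h.switching.measurable ht.le)
  -- The scheme is restarted at time `s` from the exact value `X x s ω` along the shifted path; the
  -- shifted solution solves the shifted equation.
  have hlhs : Tendsto (fun n : ℕ => ∫ ω, H ω * f (eulerPath U c (max R₀ R₁) (t / (n + 1))
      (fun u => ξ (s + u) ω) (X x s ω) (n + 1)) (ξ (s + t) ω) ∂P i) atTop
      (𝓝 (∫ ω, H ω * f (X x (s + t) ω) (ξ (s + t) ω) ∂P i)) := by
    refine tendsto_integral_filter_of_dominated_convergence (fun _ => M * B) ?_ ?_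
      (integrable_const _) ?_
    · refine Eventually.of_forall fun n => (hHm.mul (measurable_comp_pair hf ?_
        (h.switching.measurable hst))).aestronglyMeasurable
      exact (measurable_eulerPath h.contDiff.continuous hs (hτ n) hZ (n + 1)).mono
        (h.switching.history_le _) le_rfl
    · refine Eventually.of_forall fun n => Eventually.of_forall fun ω => ?_
      rw [norm_mul]
      exact mul_le_mul (hM ω) (hEbd _ _ (hbd ω s hsm) n _) (norm_nonneg _)
        ((abs_nonneg _).trans (hM ω))
    · refine Eventually.of_forall fun ω => Tendsto.const_mul _ ?_
      refine ((hf _).tendsto _).comp ?_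
      exact tendsto_eulerPath h.contDiff ((h.rightContPath ω).shift hs)
        ((h.solves x ω).shift (h.rightContPath ω) h.contDiff hs) ht
        fun u hu => (hbd ω (s + u) ⟨add_nonneg hs hu.1, by linarith [hu.2]⟩).trans
          (le_max_left _ _)
  have hQlim : ∀ y k, |y| ≤ R₀ → Tendsto (fun n : ℕ =>
      (eulerOp U c (max R₀ R₁) (t / (n + 1)) P ξ)^[n + 1] f y k) atTop
      (𝓝 (∫ ω, f (X y t ω) (ξ t ω) ∂P k)) := by
    intro y k hy
    simp only [hQ y k hy]
    refine tendsto_integral_filter_of_dominated_convergence (fun _ => B) ?_ ?_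
      (integrable_const _) ?_
    · exact Eventually.of_forall fun n => (hEm n y).aestronglyMeasurable
    · exact Eventually.of_forall fun n => Eventually.of_forall fun ω => hEbd _ y hy n _
    · refine Eventually.of_forall fun ω => ((hf _).tendsto _).comp ?_
      exact tendsto_eulerPath h.contDiff (h.rightContPath ω) (h.solves y ω) ht
        fun u hu => (hR₁ y hy u hu ω).trans (le_max_right _ _)
  have hrhs : Tendsto (fun n : ℕ => ∫ ω, H ω *
      (eulerOp U c (max R₀ R₁) (t / (n + 1)) P ξ)^[n + 1] f (X x s ω) (ξ s ω) ∂P i) atTop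
      (𝓝 (∫ ω, H ω * (∫ ω', f (X (X x s ω) t ω') (ξ t ω') ∂P (ξ s ω)) ∂P i)) := by
    refine tendsto_integral_filter_of_dominated_convergence (fun _ => M * B) ?_ ?_
      (integrable_const _) ?_
    · refine Eventually.of_forall fun n => (hHm.mul (measurable_comp_pair ?_
        (h.measurable x s hs) (h.switching.measurable hs))).aestronglyMeasurable
      exact continuous_iterate_eulerOp h.contDiff.continuous _ _ _ hf
    · refine Eventually.of_forall fun n => Eventually.of_forall fun ω => ?_
      rw [norm_mul]
      refine mul_le_mul (hM ω) ?_ (norm_nonneg _) ((abs_nonneg _).trans (hM ω))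
      rw [hQ _ _ (hbd ω s hsm)]
      refine (norm_integral_le_of_norm_le_const (C := B) (Eventually.of_forall fun ω' =>
        hEbd _ _ (hbd ω s hsm) n _)).trans_eq (by simp)
    · exact Eventually.of_forall fun ω => (hQlim _ _ (hbd ω s hsm)).const_mul _
  -- For each `n` the two approximations coincide by `integral_eulerPath`.
  refine tendsto_nhds_unique hlhs (hrhs.congr fun n => ?_)
  rw [← h.integral_eulerPath hR hs (hτ n) i hH hM hZ (fun ω => hbd ω s hsm) (n + 1) hf, hnt]

theorem measurable_joint (h : IsTelegraphFlow U c lam P ξ X) (z : ℝ × Fin 2) {t : ℝ}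
    (ht : 0 ≤ t) : Measurable (jointProcess ξ X z t) :=
  (h.measurable z.1 t ht).prodMk (h.switching.measurable ht)

/-- Continuity in the starting point and measurability in `ω` give joint measurability, hence
measurable probabilities of the sections. -/
theorem measurable_transitionLaw (h : IsTelegraphFlow U c lam P ξ X) {t : ℝ} (ht : 0 ≤ t) :
    Measurable (transitionLaw (fun z : ℝ × Fin 2 => P z.2) (jointProcess ξ X) t) := by
  have hprob := h.isProbabilityMeasure
  refine measurable_from_prod_countable_left fun i =>
    Measure.measurable_of_measurable_coe _ fun B hB => ?_
  have hX : Measurable (Function.uncurry fun x ω => X x t ω) :=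
    measurable_uncurry_of_continuous_of_measurable (fun ω => h.continuous_start ω ht)
      (fun x => h.measurable x t ht)
  have hS : MeasurableSet ((fun p : ℝ × Ω => (X p.1 t p.2, ξ t p.2)) ⁻¹' B) :=
    (hX.prodMk ((h.switching.measurable ht).comp measurable_snd)) hB
  have e : ∀ x, transitionLaw (fun z : ℝ × Fin 2 => P z.2) (jointProcess ξ X) t (x, i) B =
      P i (Prod.mk x ⁻¹' ((fun p : ℝ × Ω => (X p.1 t p.2, ξ t p.2)) ⁻¹' B)) := fun x => by
    rw [transitionLaw, Measure.map_apply (h.measurable_joint (x, i) ht) hB]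
    rfl
  simp only [e]
  exact measurable_measure_prodMk_left (ν := P i) hS

/-- As `X` is adapted, the pair has no richer past than `ξ`; a Markov property relative to the
history of `ξ` therefore suffices. -/
theorem history_joint_le (h : IsTelegraphFlow U c lam P ξ X) (z : ℝ × Fin 2) (s : ℝ) :
    history (jointProcess ξ X z) s ≤ history ξ s := by
  refine iSup₂_le fun u hu => ?_
  rw [← measurable_iff_comap_le]
  exact ((h.measurable_history z.1 hu.1).mono (history_mono hu.2) le_rfl).prodMk
    (_root_.measurable_history hu.1 hu.2)

theorem isMarkovFamily (h : IsTelegraphFlow U c lam P ξ X) :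
    IsMarkovFamily (fun z : ℝ × Fin 2 => P z.2) (jointProcess ξ X) where
  prob z := h.isProbabilityMeasure z.2
  measurable z t ht := h.measurable_joint z ht
  start z := by
    filter_upwards [h.switching.markov.start z.2] with ω hω
    simp only [jointProcess, h.apply_zero, hω]
  measurable_transitionLaw t ht := h.measurable_transitionLaw ht
  markov := by
    rintro ⟨x, i⟩ s t hs ht A hA B hB
    have hprob := h.isProbabilityMeasure
    have hst : 0 ≤ s + t := add_nonneg hs ht
    have hA' := h.history_joint_le _ _ _ hA
    have hAm := h.switching.history_le s _ hA'
    have hYs := h.measurable_joint (x, i) hs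
    have hYst := h.measurable_joint (x, i) hst
    have hq : Measurable fun ω => transitionLaw (fun z : ℝ × Fin 2 => P z.2) (jointProcess ξ X) t
        (jointProcess ξ X (x, i) s ω) := (h.measurable_transitionLaw ht).comp hYs
    -- Finite measures on the state space are determined by bounded continuous functions, so the
    -- identity for continuous `f` with `H` the indicator of `A` extends to all measurable sets `B`.
    have key : ((P i).restrict A).map (jointProcess ξ X (x, i) (s + t)) =
        ((P i).restrict A).bind fun ω => transitionLaw (fun z : ℝ × Fin 2 => P z.2)
          (jointProcess ξ X) t (jointProcess ξ X (x, i) s ω) := by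
      refine ext_of_forall_lintegral_eq_of_IsFiniteMeasure fun f => ?_
      have hfm : Measurable fun z : ℝ × Fin 2 => (f z : ENNReal) :=
        f.continuous.measurable.coe_nnreal_ennreal
      have hfc : ∀ j, Continuous fun y => ((f (y, j) : NNReal) : ℝ) := fun j =>
        NNReal.continuous_coe.comp (f.continuous.comp (by fun_prop))
      have hbd : ∀ z, (f z : ENNReal) ≤ (nndist f 0 : ENNReal) := fun z => by
        have := f.dist_coe_le_dist (g := 0) z
        rw [← coe_nndist, ← coe_nndist, NNReal.coe_le_coe] at this
        exact ENNReal.coe_le_coe.2 (by simpa using this)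
      rw [lintegral_map hfm hYst, Measure.lintegral_bind hq.aemeasurable hfm.aemeasurable]
      have hin : ∀ ω, ∫⁻ z, (f z : ENNReal) ∂transitionLaw (fun z : ℝ × Fin 2 => P z.2)
          (jointProcess ξ X) t (jointProcess ξ X (x, i) s ω) =
          ∫⁻ ω', (f (X (X x s ω) t ω', ξ t ω') : ENNReal) ∂P (ξ s ω) := fun ω => by
        rw [transitionLaw, lintegral_map hfm (h.measurable_joint _ ht)]
        rfl
      have e := h.integral_markov x hs ht i (H := indicator A 1) (M := 1)
        (measurable_indicator_one hA') (fun ω => by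
          by_cases hω : ω ∈ A <;> simp [hω])
        (f := fun y j => ((f (y, j) : NNReal) : ℝ)) hfc
      have hmul : ∀ g : Ω → ℝ, ∫ ω, indicator A 1 ω * g ω ∂P i = ∫ ω in A, g ω ∂P i := fun g => by
        rw [← integral_indicator hAm]
        refine integral_congr_ae (Eventually.of_forall fun ω => ?_)
        by_cases hω : ω ∈ A <;> simp [hω]
      rw [hmul, hmul] at e
      have hlow : ∀ (μ : Measure Ω) [IsFiniteMeasure μ] (g : Ω → ℝ × Fin 2),
          ∫⁻ ω, (f (g ω) : ENNReal) ∂μ ≠ ⊤ := fun μ _ g => by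
        refine ((lintegral_mono fun ω => hbd (g ω)).trans_lt ?_).ne
        rw [lintegral_const]
        exact ENNReal.mul_lt_top ENNReal.coe_lt_top (measure_lt_top _ _)
      have hinner : ∀ ω, ∫ ω', ((f (X (X x s ω) t ω', ξ t ω') : NNReal) : ℝ) ∂P (ξ s ω) =
          (∫⁻ ω', (f (X (X x s ω) t ω', ξ t ω') : ENNReal) ∂P (ξ s ω)).toReal := fun ω => by
        rw [integral_eq_lintegral_of_nonneg_ae (Eventually.of_forall fun _ => NNReal.coe_nonneg _)]
        · simp
        · exact (measurable_comp_pair hfc (h.measurable _ t ht)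
            (h.switching.measurable ht)).aestronglyMeasurable
      simp only [hin]
      simp only [hinner] at e
      have hmI : Measurable fun ω =>
          ∫⁻ ω', (f (X (X x s ω) t ω', ξ t ω') : ENNReal) ∂P (ξ s ω) := by
        simp only [← hin]
        exact (Measure.measurable_lintegral hfm).comp hq
      rw [integral_eq_lintegral_of_nonneg_ae (Eventually.of_forall fun _ => NNReal.coe_nonneg _)
        (measurable_comp_pair hfc (h.measurable _ _ hst)
            (h.switching.measurable hst)).aestronglyMeasurable,
        integral_toReal hmI.aemeasurable (Eventually.of_forall fun ω =>
          lt_top_iff_ne_top.2 (hlow _ _))] at e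
      rw [ENNReal.toReal_eq_toReal_iff'] at e
      · simpa [jointProcess] using e
      · simpa using hlow _ _
      · refine ((lintegral_mono (g := fun _ => (nndist f 0 : ENNReal)) fun ω => ?_).trans_lt ?_).ne
        · refine (lintegral_mono fun ω' => hbd _).trans_eq ?_
          simp
        · rw [lintegral_const]
          exact ENNReal.mul_lt_top ENNReal.coe_lt_top (measure_lt_top _ _)
    have e := DFunLike.congr_fun key B
    rw [Measure.map_apply hYst hB, Measure.restrict_apply (hYst hB),
      Measure.bind_apply hB hq.aemeasurable] at e
    rw [inter_comm]
    exact e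

end IsTelegraphFlow

/-! ### The infinitesimal generator -/

theorem hasDerivWithinAt_Ici_of_tendsto {u : ℝ → ℝ} {a t : ℝ}
    (hu : Tendsto (fun h => (u (t + h) - u t) / h) (𝓝[>] 0) (𝓝 a)) :
    HasDerivWithinAt u a (Ici t) t := by
  rw [← hasDerivWithinAt_Ioi_iff_Ici, hasDerivWithinAt_iff_tendsto_slope' (by simp)]
  have h1 : Tendsto (fun s => s - t) (𝓝[>] t) (𝓝[>] 0) := by
    refine tendsto_nhdsWithin_iff.2 ⟨?_, ?_⟩
    · have : Continuous fun s : ℝ => s - t := by fun_prop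
      simpa using (this.tendsto t).mono_left nhdsWithin_le_nhds
    · filter_upwards [self_mem_nhdsWithin] with s hs
      exact sub_pos.2 (mem_Ioi.1 hs)
  refine (hu.comp h1).congr fun s => ?_
  simp [slope_def_field]

theorem IsSwitchingProcess.hasDerivWithinAt_measureReal {Ω : Type*} [MeasurableSpace Ω]
    {lam : Fin 2 → ℝ} {P : Fin 2 → Measure Ω} {ξ : ℝ → Ω → Fin 2}
    (hξ : IsSwitchingProcess lam P ξ) (i j : Fin 2) :
    HasDerivWithinAt (fun t : ℝ => (P i).real {ω | ξ t ω = j})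
      (switchingMatrix lam i j) (Ici 0) 0 := by
  have := hξ.isProbabilityMeasure
  refine hasDerivWithinAt_Ici_of_tendsto ?_
  have h0 : (P i).real {ω | ξ 0 ω = j} = if i = j then 1 else 0 := by
    have : (P i).real {ω | ξ 0 ω = j} = (P i).real {_ω | i = j} := by
      refine measureReal_congr ?_
      filter_upwards [hξ.markov.start i] with ω hω
      refine propext ?_
      change ξ 0 ω = j ↔ i = j
      rw [hω]
    rw [this]
    split_ifs with h <;> simp [h]
  simp only [zero_add, h0]
  by_cases hij : i = j
  · subst hij
    have e : switchingMatrix lam i i = -lam i := by fin_cases i <;> simp [switchingMatrix]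
    rw [e]
    refine (hξ.intensity i).neg.congr' ?_
    filter_upwards [self_mem_nhdsWithin] with t ht
    have := probReal_compl_eq_one_sub (μ := P i) (hξ.measurableSet_eq (mem_Ioi.1 ht).le i)
    have e : {ω | ξ t ω = i}ᶜ = {ω | ξ t ω ≠ i} := rfl
    rw [e] at this
    rw [this]
    simp only [if_true]
    ring
  · have e : switchingMatrix lam i j = lam i := by
      fin_cases i <;> fin_cases j <;> simp [switchingMatrix] at *
    rw [e]
    refine (hξ.intensity i).congr fun t => ?_
    have e : {ω | ξ t ω ≠ i} = {ω | ξ t ω = j} := by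
      ext ω
      change ξ t ω ≠ i ↔ ξ t ω = j
      generalize ξ t ω = k
      fin_cases i <;> fin_cases j <;> fin_cases k <;> simp at *
    simp [e, hij]

theorem continuous_telegraphGenerator {U : ℝ → ℝ} {c lam : Fin 2 → ℝ}
    (hU : Continuous (deriv U)) {f : ℝ → Fin 2 → ℝ} (hf : ∀ j, ContDiff ℝ 1 fun x => f x j)
    (i : Fin 2) : Continuous fun x => telegraphGenerator U c lam f x i := by
  have h1 : ∀ j, Continuous fun x => f x j := fun j => (hf j).continuous
  have h2 : ∀ j, Continuous (deriv fun x => f x j) := fun j => (hf j).continuous_deriv le_rfl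
  unfold telegraphGenerator driftOp
  refine Continuous.add ?_ ((continuous_const.sub hU).mul (h2 i))
  simp only [Matrix.mulVec, dotProduct]
  exact continuous_finsetSum _ fun j _ => continuous_const.mul (h1 j)

/-- In `Fin 2` the state other than `i` is `1 - i`. -/
theorem switchingMatrix_mulVec (lam v : Fin 2 → ℝ) (i : Fin 2) :
    (switchingMatrix lam).mulVec v i = (v (1 - i) - v i) * lam i := by
  fin_cases i <;> simp [switchingMatrix, Matrix.mulVec, dotProduct] <;> ring

namespace IsTelegraphFlow

variable {Ω : Type*} [MeasurableSpace Ω] {U : ℝ → ℝ} {c lam : Fin 2 → ℝ}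
  {P : Fin 2 → Measure Ω} {ξ : ℝ → Ω → Fin 2} {X : ℝ → ℝ → Ω → ℝ}

theorem measurable_comp (h : IsTelegraphFlow U c lam P ξ X) {f : ℝ → Fin 2 → ℝ}
    (hf : ∀ j, Continuous fun x => f x j) {t : ℝ} (ht : 0 ≤ t) (x : ℝ) :
    Measurable fun ω => f (X x t ω) (ξ t ω) :=
  measurable_comp_pair hf (h.measurable x t ht) (h.switching.measurable ht)

theorem integrable_comp (h : IsTelegraphFlow U c lam P ξ X) {f : ℝ → Fin 2 → ℝ}
    (hf : ∀ j, Continuous fun x => f x j) {t : ℝ} (ht : 0 ≤ t) (x : ℝ) (i : Fin 2) :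
    Integrable (fun ω => f (X x t ω) (ξ t ω)) (P i) := by
  have := h.isProbabilityMeasure
  obtain ⟨M, -, hM⟩ := h.exists_bound_family hf |x| t
  exact Integrable.of_bound (h.measurable_comp hf ht x).aestronglyMeasurable M
    (Eventually.of_forall fun ω => hM x le_rfl t ⟨ht, le_rfl⟩ ω _)

theorem integral_apply_switching_sub (h : IsTelegraphFlow U c lam P ξ X) (v : Fin 2 → ℝ) {t : ℝ}
    (ht : 0 ≤ t) (i : Fin 2) :
    ∫ ω, (v (ξ t ω) - v i) ∂P i = (v (1 - i) - v i) * (P i).real {ω | ξ t ω ≠ i} := by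
  have := h.isProbabilityMeasure
  have hm : MeasurableSet {ω | ξ t ω ≠ i} := (h.switching.measurableSet_eq ht i).compl
  rw [← integral_indicator_one hm, ← integral_const_mul]
  refine integral_congr_ae (Eventually.of_forall fun ω => ?_)
  simp only [indicator_apply, mem_ofPred_eq, Pi.one_apply]
  generalize ξ t ω = k
  fin_cases i <;> fin_cases k <;> simp

/-- The displacement in a short time is at most proportional to the time. -/
theorem exists_displacement_bound (h : IsTelegraphFlow U c lam P ξ X) (r T : ℝ) :
    ∃ V, 0 ≤ V ∧ ∀ x, |x| ≤ r → ∀ t ∈ Icc 0 T, ∀ ω, |X x t ω - x| ≤ V * t := by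
  obtain ⟨W, hW0, hW⟩ := h.exists_bound_comp h.contDiff.continuous r T
  refine ⟨|c 0| + |c 1| + W, by positivity, fun x hx t ht ω => ?_⟩
  have := (h.solves x ω).abs_sub_le h.contDiff (h.rightContPath ω) le_rfl ht.1
    (V := |c 0| + |c 1| + W) fun u hu => (abs_sub _ _).trans
      (add_le_add (RightContPath.abs_apply_le c _) (hW x hx u ⟨hu.1, hu.2.trans ht.2⟩ ω))
  simpa [h.apply_zero] using this

/-- Rescaled to `[0, 1]`, the drift integral is a continuous function of time and starting point.
The telegraph part does not involve the starting point, and its limit is a right derivative at `0`.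
-/
theorem tendsto_displacement_div (h : IsTelegraphFlow U c lam P ξ X) (x : ℝ) (ω : Ω) :
    Tendsto (fun p : ℝ × ℝ => (X p.2 p.1 ω - p.2) / p.1) (𝓝[>] 0 ×ˢ 𝓝 x)
      (𝓝 (c (ξ 0 ω) - deriv U x)) := by
  have hle : 𝓝[>] (0 : ℝ) ×ˢ 𝓝 x ≤ 𝓝 (0, x) := by
    rw [nhds_prod_eq]; exact Filter.prod_mono nhdsWithin_le_nhds le_rfl
  have h1 : Tendsto (fun p : ℝ × ℝ => ∫ θ in (0 : ℝ)..1, deriv U (X p.2 (max (p.1 * θ) 0) ω))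
      (𝓝[>] 0 ×ˢ 𝓝 x) (𝓝 (deriv U x)) := by
    have hc : Continuous fun p : ℝ × ℝ =>
        ∫ θ in (0 : ℝ)..1, deriv U (X p.2 (max (p.1 * θ) 0) ω) := by
      refine intervalIntegral.continuous_parametric_intervalIntegral_of_continuous'
        (f := fun (p : ℝ × ℝ) θ => deriv U (X p.2 (max (p.1 * θ) 0) ω)) ?_ 0 1
      exact h.contDiff.continuous.comp ((h.continuous_uncurry ω).comp
        (by fun_prop : Continuous fun q : (ℝ × ℝ) × ℝ => (q.1.2, q.1.1 * q.2)))
    have := (hc.tendsto (0, x)).mono_left hle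
    simpa [h.apply_zero] using this
  have h2 : Tendsto (fun t => telegraph c (fun s => ξ s ω) t / t) (𝓝[>] 0) (𝓝 (c (ξ 0 ω))) := by
    have := (h.rightContPath ω).hasDerivWithinAt_telegraph c le_rfl
    rw [← hasDerivWithinAt_Ioi_iff_Ici, hasDerivWithinAt_iff_tendsto_slope' (by simp)] at this
    refine this.congr fun t => ?_
    simp [slope_def_field, telegraph]
  refine ((h2.comp tendsto_fst).sub h1).congr' ?_
  have hpos : ∀ᶠ p : ℝ × ℝ in 𝓝[>] 0 ×ˢ 𝓝 x, 0 < p.1 :=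
    tendsto_fst.eventually (self_mem_nhdsWithin : ∀ᶠ t in 𝓝[>] (0 : ℝ), 0 < t)
  filter_upwards [hpos] with p hp
  have e := intervalIntegral.mul_integral_comp_mul_left (a := 0) (b := 1)
    (f := fun s => deriv U (X p.2 s ω)) p.1
  have e2 : (∫ θ in (0 : ℝ)..1, deriv U (X p.2 (max (p.1 * θ) 0) ω)) =
      ∫ θ in (0 : ℝ)..1, deriv U (X p.2 (p.1 * θ) ω) := by
    refine intervalIntegral.integral_congr fun θ hθ => ?_
    rw [uIcc_of_le zero_le_one] at hθ
    simp [max_eq_left (mul_nonneg hp.le hθ.1)]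
  rw [mul_zero, mul_one] at e
  have := (h.solves p.2 ω).eqn p.1 hp.le
  rw [this, e2, ← e]
  simp only [Function.comp]
  field_simp
  ring

/-- The generator, along all starting points near `x` simultaneously. -/
theorem tendsto_generator (h : IsTelegraphFlow U c lam P ξ X) {f : ℝ → Fin 2 → ℝ}
    (hf : ∀ j, ContDiff ℝ 1 fun x => f x j) (x : ℝ) (i : Fin 2) :
    Tendsto (fun p : ℝ × ℝ => ((∫ ω, f (X p.2 p.1 ω) (ξ p.1 ω) ∂P i) - f p.2 i) / p.1)
      (𝓝[>] 0 ×ˢ 𝓝 x) (𝓝 (telegraphGenerator U c lam f x i)) := by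
  have hprob := h.isProbabilityMeasure
  have hfc : ∀ j, Continuous fun x => f x j := fun j => (hf j).continuous
  have hle : 𝓝[>] (0 : ℝ) ×ˢ 𝓝 x ≤ 𝓝 (0, x) := by
    rw [nhds_prod_eq]; exact Filter.prod_mono nhdsWithin_le_nhds le_rfl
  have hpos : ∀ᶠ p : ℝ × ℝ in 𝓝[>] 0 ×ˢ 𝓝 x, 0 < p.1 :=
    tendsto_fst.eventually (self_mem_nhdsWithin : ∀ᶠ t in 𝓝[>] (0 : ℝ), 0 < t)
  have hone : ∀ᶠ p : ℝ × ℝ in 𝓝[>] 0 ×ˢ 𝓝 x, p.1 < 1 :=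
    tendsto_fst.eventually (nhdsWithin_le_nhds (gt_mem_nhds one_pos))
  have hball : ∀ᶠ p : ℝ × ℝ in 𝓝[>] 0 ×ˢ 𝓝 x, |p.2| ≤ |x| + 1 :=
    tendsto_snd.eventually ((continuous_abs.tendsto x).eventually
      (ge_mem_nhds (lt_add_one |x|)))
  -- Part of the increment in which the position is fixed and only the state changes: an exact
  -- multiple of the switching probability.
  have hswitch : Tendsto (fun p : ℝ × ℝ => (f p.2 (1 - i) - f p.2 i) *
      ((P i).real {ω | ξ p.1 ω ≠ i} / p.1)) (𝓝[>] 0 ×ˢ 𝓝 x)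
      (𝓝 ((switchingMatrix lam).mulVec (f x) i)) := by
    rw [switchingMatrix_mulVec]
    exact ((((hfc _).sub (hfc _)).tendsto x).comp tendsto_snd).mul
      ((h.switching.intensity i).comp tendsto_fst)
  obtain ⟨R, hR0, hR⟩ := h.exists_bound (|x| + 1) 1
  obtain ⟨V, hV0, hV⟩ := h.exists_displacement_bound (|x| + 1) 1
  obtain ⟨L, hL0, hL⟩ : ∃ L, 0 ≤ L ∧ ∀ j p q, |p| ≤ R → |q| ≤ R →
      |avgDeriv (fun x => f x j) p q| ≤ L := by
    choose L hL using fun j => (isCompact_Icc.prod isCompact_Icc).exists_bound_of_continuousOn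
      (s := Icc (-R) R ×ˢ Icc (-R) R) (continuous_avgDeriv (hf j)).continuousOn
    have h0 : (0 : ℝ) ∈ Icc (-R) R := ⟨by linarith, hR0⟩
    refine ⟨max (L 0) (L 1), le_max_of_le_left ((norm_nonneg _).trans (hL 0 (0, 0) ⟨h0, h0⟩)),
      fun j p q hp hq => (hL j (p, q) ⟨abs_le.1 hp, abs_le.1 hq⟩).trans ?_⟩
    fin_cases j <;> simp
  -- Part in which the state `ξ(h)` is fixed and the position moves: mean derivative times
  -- displacement, bounded by `L * V * h`. Along almost every path `ξ(h) = i` for small `h`, so the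
  -- limit is the constant `L_i f_i`.
  have hdrift : Tendsto (fun p : ℝ × ℝ =>
      ∫ ω, (f (X p.2 p.1 ω) (ξ p.1 ω) - f p.2 (ξ p.1 ω)) / p.1 ∂P i) (𝓝[>] 0 ×ˢ 𝓝 x)
      (𝓝 (driftOp U c i (fun y => f y i) x)) := by
    have e : driftOp U c i (fun y => f y i) x =
        ∫ _, driftOp U c i (fun y => f y i) x ∂P i := by simp
    rw [e]
    refine tendsto_integral_filter_of_dominated_convergence (fun _ => L * V) ?_ ?_
      (integrable_const _) ?_
    · filter_upwards [hpos] with p hp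
      exact (((h.measurable_comp hfc hp.le p.2).sub ((measurable_of_countable (f p.2)).comp
        (h.switching.measurable hp.le))).div_const _).aestronglyMeasurable
    · filter_upwards [hpos, hone, hball] with p hp hp1 hp2
      refine Eventually.of_forall fun ω => ?_
      have hmem : p.1 ∈ Icc (0 : ℝ) 1 := ⟨hp.le, hp1.le⟩
      rw [← avgDeriv_mul_sub (hf (ξ p.1 ω)), norm_div, norm_mul, Real.norm_eq_abs,
        Real.norm_eq_abs, Real.norm_eq_abs, abs_of_pos hp, div_le_iff₀ hp, mul_assoc]
      refine mul_le_mul (hL _ _ _ ?_ (hR _ hp2 _ hmem ω)) (hV _ hp2 _ hmem ω) (abs_nonneg _) hL0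
      simpa [h.apply_zero] using hR _ hp2 0 ⟨le_rfl, zero_le_one⟩ ω
    · filter_upwards [h.switching.markov.start i] with ω hω
      have hξi : ∀ᶠ p : ℝ × ℝ in 𝓝[>] 0 ×ˢ 𝓝 x, ξ p.1 ω = i := by
        have := (h.rightContPath ω).eventually_eq le_rfl
        rw [hω] at this
        exact tendsto_fst.eventually (this.filter_mono (nhdsWithin_mono _ Ioi_subset_Ici_self))
      have ha : Tendsto (fun p : ℝ × ℝ =>
          avgDeriv (fun y => f y i) p.2 (X p.2 (max p.1 0) ω)) (𝓝[>] 0 ×ˢ 𝓝 x)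
          (𝓝 (deriv (fun y => f y i) x)) := by
        have hc : Continuous fun p : ℝ × ℝ =>
            avgDeriv (fun y => f y i) p.2 (X p.2 (max p.1 0) ω) :=
          (continuous_avgDeriv (hf i)).comp (continuous_snd.prodMk
            ((h.continuous_uncurry ω).comp (continuous_snd.prodMk continuous_fst)))
        have := (hc.tendsto (0, x)).mono_left hle
        simpa [h.apply_zero] using this
      have hd := h.tendsto_displacement_div x ω
      rw [hω] at hd
      rw [driftOp, mul_comm]
      refine (ha.mul hd).congr' ?_
      filter_upwards [hpos, hξi] with p hp hpi
      rw [hpi, max_eq_left hp.le, ← avgDeriv_mul_sub (hf i), mul_div_assoc]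
  refine (hswitch.add hdrift).congr' ?_
  filter_upwards [hpos] with p hp
  have i1 := h.integrable_comp hfc hp.le p.2 i
  have i2 : Integrable (fun ω => f p.2 (ξ p.1 ω)) (P i) :=
    Integrable.of_bound ((measurable_of_countable (f p.2)).comp
      (h.switching.measurable hp.le)).aestronglyMeasurable (|f p.2 0| + |f p.2 1|)
      (Eventually.of_forall fun ω => RightContPath.abs_apply_le (f p.2) _)
  have e := h.integral_apply_switching_sub (f p.2) hp.le i
  rw [integral_sub i2 (integrable_const _)] at e
  rw [integral_div, integral_sub i1 i2, ← mul_div_assoc, ← e]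
  simp only [integral_const, probReal_univ, one_smul]
  ring

/-- The limit is continuous, so the joint limit in time and starting point gives local uniformity;
the state is a discrete variable and may be held fixed. -/
theorem tendstoLocallyUniformly_generator (h : IsTelegraphFlow U c lam P ξ X)
    {f : ℝ → Fin 2 → ℝ} (hf : ∀ j, ContDiff ℝ 1 fun x => f x j) :
    TendstoLocallyUniformly
      (fun (h : ℝ) (z : ℝ × Fin 2) =>
        (markovSemigroup (fun z : ℝ × Fin 2 => P z.2) (jointProcess ξ X) h
          (fun w => f w.1 w.2) z - f z.1 z.2) / h)
      (fun z => telegraphGenerator U c lam f z.1 z.2) (𝓝[>] 0) := by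
  rw [tendstoLocallyUniformly_iff_forall_tendsto]
  rintro ⟨x, i⟩
  rw [nhds_prod_eq, nhds_discrete (Fin 2), Filter.prod_pure, Filter.prod_map_right, tendsto_map'_iff]
  refine Tendsto.mono_right ?_ (nhds_le_uniformity (telegraphGenerator U c lam f x i))
  rw [nhds_prod_eq]
  exact (((continuous_telegraphGenerator h.contDiff.continuous hf i).tendsto x).comp
    tendsto_snd).prodMk (h.tendsto_generator hf x i)

/-- In a short time the solution can not enter `[-r, r]` from outside of `[-r-1, r+1]`. -/
theorem exists_time_abs_gt (h : IsTelegraphFlow U c lam P ξ X) {r : ℝ} (hr : 0 ≤ r) :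
    ∃ T > 0, ∀ t ∈ Icc 0 T, ∀ x, r + 1 < |x| → ∀ ω, r < |X x t ω| := by
  obtain ⟨W, hW⟩ := isCompact_Icc.exists_bound_of_continuousOn (s := Icc (-(r + 1)) (r + 1))
    h.contDiff.continuous.continuousOn
  have hW0 : 0 ≤ W := (norm_nonneg _).trans (hW 0 ⟨by linarith, by linarith⟩)
  set V := |c 0| + |c 1| + W with hVdef
  have hV0 : 0 ≤ V := by positivity
  -- While `|X| ≤ r + 1` the speed is at most `V`, so the distance covered in this time is at most
  -- `V / (V + 1) < 1`, less than the gap between `r + 1` and `r`.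
  refine ⟨1 / (V + 1), by positivity, fun t ht x hx ω => ?_⟩
  by_contra! hcon
  have hcont : ContinuousOn (fun u => |X x u ω|) (Ici 0) := (h.solves x ω).cont.abs
  have hS : IsCompact (Icc 0 t ∩ (fun u => |X x u ω|) ⁻¹' {r + 1}) :=
    isCompact_Icc.of_isClosed_subset
      ((hcont.mono Icc_subset_Ici_self).preimage_isClosed_of_isClosed isClosed_Icc
        isClosed_singleton) inter_subset_left
  have hne : (Icc 0 t ∩ (fun u => |X x u ω|) ⁻¹' {r + 1}).Nonempty := by
    obtain ⟨u, hu, hu'⟩ := intermediate_value_Icc' ht.1 (hcont.mono Icc_subset_Ici_self)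
      (show r + 1 ∈ Icc |X x t ω| |X x 0 ω| from
        ⟨by linarith, by rw [h.apply_zero]; exact hx.le⟩)
    exact ⟨u, hu, hu'⟩
  -- `s` is the last time at which `|X| = r + 1`; from then on the speed bound holds.
  obtain ⟨s, ⟨hs, hs'⟩, hmax⟩ := hS.exists_isGreatest hne
  have hs' : |X x s ω| = r + 1 := hs'
  have hin : ∀ u ∈ Icc s t, |X x u ω| ≤ r + 1 := by
    intro u hu
    by_contra! hgt
    obtain ⟨v, hv, hv'⟩ := intermediate_value_Icc' hu.2
      (hcont.mono fun w hw => (hs.1.trans hu.1).trans hw.1)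
      (show r + 1 ∈ Icc |X x t ω| |X x u ω| from ⟨by linarith, hgt.le⟩)
    have h1 := hmax ⟨⟨(hs.1.trans hu.1).trans hv.1, hv.2⟩, hv'⟩
    have h2 : u = s := le_antisymm (hv.1.trans h1) hu.1
    rw [h2, hs'] at hgt
    exact lt_irrefl _ hgt
  have hmove := (h.solves x ω).abs_sub_le h.contDiff (h.rightContPath ω) hs.1 hs.2 (V := V)
    fun u hu => (abs_sub _ _).trans (add_le_add (RightContPath.abs_apply_le c _)
      (hW _ (abs_le.1 (hin u hu))))
  have h3 := abs_sub_abs_le_abs_sub (X x s ω) (X x t ω)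
  rw [abs_sub_comm] at h3
  have h4 : V * (t - s) ≤ V * (1 / (V + 1)) :=
    mul_le_mul_of_nonneg_left (by linarith [hs.1, ht.2]) hV0
  have h5 : V * (1 / (V + 1)) < 1 := by
    rw [mul_one_div, div_lt_one (by positivity)]
    linarith
  linarith

/-- On the compact set `|x| ≤ r + 1` local uniformity is uniformity. Outside it both sides vanish
for short times, since the solution has not yet reached the support of `f`. -/
theorem tendstoUniformly_generator (h : IsTelegraphFlow U c lam P ξ X)
    {f : ℝ → Fin 2 → ℝ} (hf : ∀ j, ContDiff ℝ 1 fun x => f x j)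
    (hfs : ∀ j, HasCompactSupport fun x => f x j) :
    TendstoUniformly
      (fun (h : ℝ) (z : ℝ × Fin 2) =>
        (markovSemigroup (fun z : ℝ × Fin 2 => P z.2) (jointProcess ξ X) h
          (fun w => f w.1 w.2) z - f z.1 z.2) / h)
      (fun z => telegraphGenerator U c lam f z.1 z.2) (𝓝[>] 0) := by
  obtain ⟨r, hr0, hr⟩ : ∃ r, 0 ≤ r ∧ ∀ x, r < |x| → ∀ j, f x j = 0 := by
    choose r hr using fun j => (hfs j).isCompact.isBounded.subset_closedBall (0 : ℝ)
    refine ⟨max 0 (max (r 0) (r 1)), le_max_left _ _, fun x hx j => ?_⟩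
    by_contra hne
    have h1 := hr j (subset_tsupport _ hne)
    rw [mem_closedBall_zero_iff, Real.norm_eq_abs] at h1
    have h2 : r j ≤ max (r 0) (r 1) := by fin_cases j <;> simp
    linarith [le_max_right 0 (max (r 0) (r 1))]
  obtain ⟨T, hT, hout⟩ := h.exists_time_abs_gt hr0
  have hK : IsCompact (Icc (-(r + 1)) (r + 1) ×ˢ (univ : Set (Fin 2))) :=
    isCompact_Icc.prod isCompact_univ
  have hloc := (tendstoLocallyUniformlyOn_iff_tendstoUniformlyOn_of_compact hK).1
    (h.tendstoLocallyUniformly_generator hf).tendstoLocallyUniformlyOn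
  rw [Metric.tendstoUniformlyOn_iff] at hloc
  rw [Metric.tendstoUniformly_iff]
  intro ε hε
  have hTmem : ∀ᶠ t in 𝓝[>] (0 : ℝ), t ∈ Icc 0 T :=
    mem_of_superset (Ioc_mem_nhdsGT hT) Ioc_subset_Icc_self
  filter_upwards [hloc ε hε, hTmem] with t ht htT
  rintro ⟨x, i⟩
  by_cases hx : |x| ≤ r + 1
  · exact ht (x, i) ⟨abs_le.1 hx, mem_univ _⟩
  · have hx : r + 1 < |x| := not_le.1 hx
    have e1 : markovSemigroup (fun z : ℝ × Fin 2 => P z.2) (jointProcess ξ X) t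
        (fun w => f w.1 w.2) (x, i) = 0 := by
      simp [markovSemigroup, jointProcess, hr _ (hout t htT x hx _)]
    have e2 : f x = 0 := funext fun j => hr x (by linarith) j
    have e3 : deriv (fun y => f y i) x = 0 := by
      have : (fun y => f y i) =ᶠ[𝓝 x] fun _ => 0 := by
        filter_upwards [(continuous_abs.tendsto x).eventually
          (lt_mem_nhds (by linarith : r < |x|))] with y hy
        exact hr y hy i
      rw [this.deriv_eq]
      simp
    simp [e1, telegraphGenerator, driftOp, e2, e3, hε]

end IsTelegraphFlow

/-! ### The backward equation -/

namespace IsTelegraphFlow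

variable {Ω : Type*} [MeasurableSpace Ω] {U : ℝ → ℝ} {c lam : Fin 2 → ℝ}
  {P : Fin 2 → Measure Ω} {ξ : ℝ → Ω → Fin 2} {X : ℝ → ℝ → Ω → ℝ}

/-- The semigroup of the pair `(X, ξ)`, on vector functions. -/
noncomputable def semigroup (P : Fin 2 → Measure Ω) (ξ : ℝ → Ω → Fin 2) (X : ℝ → ℝ → Ω → ℝ)
    (f : ℝ → Fin 2 → ℝ) (t x : ℝ) (i : Fin 2) : ℝ :=
  ∫ ω, f (X x t ω) (ξ t ω) ∂P i

/-- The derivative of `semigroup` with respect to the starting point. -/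
noncomputable def semigroupDeriv (U : ℝ → ℝ) (P : Fin 2 → Measure Ω) (ξ : ℝ → Ω → Fin 2)
    (X : ℝ → ℝ → Ω → ℝ) (f : ℝ → Fin 2 → ℝ) (t x : ℝ) (i : Fin 2) : ℝ :=
  ∫ ω, deriv (fun y => f y (ξ t ω)) (X x t ω) * flowSlope U X ω x x t ∂P i

theorem exists_bound_deriv (h : IsTelegraphFlow U c lam P ξ X) {f : ℝ → Fin 2 → ℝ}
    (hf : ∀ j, ContDiff ℝ 1 fun x => f x j) (r T : ℝ) :
    ∃ M, 0 ≤ M ∧ ∀ x, |x| ≤ r → ∀ t ∈ Icc 0 T, ∀ ω j,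
      |deriv (fun y => f y j) (X x t ω) * flowSlope U X ω x x t| ≤ M := by
  obtain ⟨M, hM0, hM⟩ := h.exists_bound_family (f := fun x j => deriv (fun y => f y j) x)
    (fun j => (hf j).continuous_deriv le_rfl) r T
  obtain ⟨K, hK0, hK⟩ := h.exists_flowSlope_bound r T
  refine ⟨M * K, mul_nonneg hM0 hK0, fun x hx t ht ω j => ?_⟩
  rw [abs_mul, abs_of_pos (flowSlope_pos ω x x t)]
  exact mul_le_mul (hM x hx t ht ω j) (hK x x hx hx t ht ω) (flowSlope_pos _ _ _ _).le hM0

theorem measurable_deriv_comp (h : IsTelegraphFlow U c lam P ξ X) {f : ℝ → Fin 2 → ℝ}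
    (hf : ∀ j, ContDiff ℝ 1 fun x => f x j) {t : ℝ} (ht : 0 ≤ t) (x : ℝ) :
    Measurable fun ω => deriv (fun y => f y (ξ t ω)) (X x t ω) * flowSlope U X ω x x t :=
  (h.measurable_comp (f := fun x j => deriv (fun y => f y j) x)
    (fun j => (hf j).continuous_deriv le_rfl) ht x).mul (h.measurable_flowSlope_self ht x)

theorem hasDerivAt_semigroup (h : IsTelegraphFlow U c lam P ξ X) {f : ℝ → Fin 2 → ℝ}
    (hf : ∀ j, ContDiff ℝ 1 fun x => f x j) {t : ℝ} (ht : 0 ≤ t) (x : ℝ) (i : Fin 2) :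
    HasDerivAt (fun y => semigroup P ξ X f t y i) (semigroupDeriv U P ξ X f t x i) x := by
  have := h.isProbabilityMeasure
  have hfc : ∀ j, Continuous fun x => f x j := fun j => (hf j).continuous
  obtain ⟨M, -, hM⟩ := h.exists_bound_deriv hf (|x| + 1) t
  refine (hasDerivAt_integral_of_dominated_loc_of_deriv_le (μ := P i)
    (F := fun y ω => f (X y t ω) (ξ t ω))
    (F' := fun y ω => deriv (fun y => f y (ξ t ω)) (X y t ω) * flowSlope U X ω y y t)
    (bound := fun _ => M) (Metric.ball_mem_nhds x one_pos) ?_ ?_ ?_ ?_ ?_ ?_).2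
  · exact Eventually.of_forall fun y => (h.measurable_comp hfc ht y).aestronglyMeasurable
  · exact h.integrable_comp hfc ht x i
  · exact (h.measurable_deriv_comp hf ht x).aestronglyMeasurable
  · refine Eventually.of_forall fun ω y hy => hM y ?_ t ⟨ht, le_rfl⟩ ω _
    have h1 := abs_sub_abs_le_abs_sub y x
    rw [Metric.mem_ball, Real.dist_eq] at hy
    linarith
  · exact integrable_const _
  · exact Eventually.of_forall fun ω y _ =>
      (((hf (ξ t ω)).differentiable one_ne_zero _).hasDerivAt).comp y (h.hasDerivAt_start ω ht y)

theorem continuous_semigroupDeriv (h : IsTelegraphFlow U c lam P ξ X) {f : ℝ → Fin 2 → ℝ}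
    (hf : ∀ j, ContDiff ℝ 1 fun x => f x j) {t : ℝ} (ht : 0 ≤ t) (i : Fin 2) :
    Continuous fun x => semigroupDeriv U P ξ X f t x i := by
  have := h.isProbabilityMeasure
  rw [continuous_iff_continuousAt]
  intro x
  obtain ⟨M, -, hM⟩ := h.exists_bound_deriv hf (|x| + 1) t
  refine tendsto_integral_filter_of_dominated_convergence (fun _ => M) ?_ ?_
    (integrable_const _) ?_
  · exact Eventually.of_forall fun y => (h.measurable_deriv_comp hf ht y).aestronglyMeasurable
  · filter_upwards [(continuous_abs.tendsto x).eventually (ge_mem_nhds (lt_add_one |x|))] with y hy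
    exact Eventually.of_forall fun ω => hM y hy t ⟨ht, le_rfl⟩ ω _
  · refine Eventually.of_forall fun ω => ?_
    have h1 : Continuous fun y => deriv (fun y => f y (ξ t ω)) (X y t ω) :=
      ((hf (ξ t ω)).continuous_deriv le_rfl).comp (h.continuous_start ω ht)
    have h2 : Continuous fun y => flowSlope U X ω y y t :=
      (h.continuous_flowSlope ω).comp (by fun_prop : Continuous fun y : ℝ => ((y, y), t))
    exact (h1.mul h2).tendsto x

/-- This regularity allows the generator to be applied to `P_t f`, which is what the backward
equation requires. -/
theorem contDiff_semigroup (h : IsTelegraphFlow U c lam P ξ X) {f : ℝ → Fin 2 → ℝ}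
    (hf : ∀ j, ContDiff ℝ 1 fun x => f x j) {t : ℝ} (ht : 0 ≤ t) (i : Fin 2) :
    ContDiff ℝ 1 fun x => semigroup P ξ X f t x i := by
  rw [contDiff_one_iff_deriv]
  refine ⟨fun x => (h.hasDerivAt_semigroup hf ht x i).differentiableAt, ?_⟩
  rw [funext fun x => (h.hasDerivAt_semigroup hf ht x i).deriv]
  exact h.continuous_semigroupDeriv hf ht i

/-- The switching process is stochastically continuous. -/
theorem tendsto_measureReal_ne (h : IsTelegraphFlow U c lam P ξ X) {t : ℝ} (ht : 0 ≤ t)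
    (i : Fin 2) :
    Tendsto (fun s => (P i).real {ω | ξ s ω ≠ ξ t ω}) (𝓝[Ici 0] t) (𝓝 0) := by
  have hprob := h.isProbabilityMeasure
  have hq0 : ∀ k, (P k).real {ω | ξ 0 ω ≠ k} = 0 := fun k => by
    rw [measureReal_eq_zero_iff]
    exact h.switching.markov.start k
  have hq : ∀ k, Tendsto (fun u => (P k).real {ω | ξ u ω ≠ k}) (𝓝[≥] 0) (𝓝 0) := fun k => by
    have h1 : ContinuousWithinAt (fun u => (P k).real {ω | ξ u ω ≠ k}) (Ioi 0) 0 := by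
      rw [ContinuousWithinAt, hq0]
      exact h.switching.tendsto_measureReal_ne k
    have h2 := continuousWithinAt_Ioi_iff_Ici.1 h1
    rwa [ContinuousWithinAt, hq0] at h2
  have habs : Tendsto (fun s => |s - t|) (𝓝[Ici 0] t) (𝓝[≥] 0) := by
    refine tendsto_nhdsWithin_iff.2 ⟨?_, Eventually.of_forall fun s => mem_Ici.2 (abs_nonneg _)⟩
    have : Continuous fun s : ℝ => |s - t| := by fun_prop
    simpa using (this.tendsto t).mono_left nhdsWithin_le_nhds
  have hsum : Tendsto (fun s => ∑ k, (P k).real {ω | ξ |s - t| ω ≠ k}) (𝓝[Ici 0] t) (𝓝 0) := by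
    simpa using tendsto_finsetSum Finset.univ fun k _ => (hq k).comp habs
  refine squeeze_zero' (Eventually.of_forall fun _ => measureReal_nonneg) ?_ hsum
  filter_upwards [self_mem_nhdsWithin] with s hs
  -- The Markov property is applied at the earlier of the two times; the bound depends on `|s - t|`
  -- only.
  rcases le_total t s with hts | hts
  · have := h.switching.measureReal_ne_le ht (sub_nonneg.2 hts) i
    rw [abs_of_nonneg (sub_nonneg.2 hts)]
    simpa using this
  · have := h.switching.measureReal_ne_le (mem_Ici.1 hs) (sub_nonneg.2 hts) i
    rw [abs_sub_comm, abs_of_nonneg (sub_nonneg.2 hts)]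
    simpa [eq_comm] using this

/-- Expectations of functions of `ξ(t)` that depend continuously on `t` are continuous. -/
theorem continuousOn_integral (h : IsTelegraphFlow U c lam P ξ X) (i : Fin 2)
    {G : ℝ → Ω → Fin 2 → ℝ} (hGm : ∀ t, 0 ≤ t → ∀ j, Measurable fun ω => G t ω j)
    (hGc : ∀ ω j, ContinuousOn (fun t => G t ω j) (Ici 0))
    (hGb : ∀ T, ∃ M, ∀ t ∈ Icc 0 T, ∀ ω j, |G t ω j| ≤ M) :
    ContinuousOn (fun t => ∫ ω, G t ω (ξ t ω) ∂P i) (Ici 0) := by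
  have hprob := h.isProbabilityMeasure
  intro t ht
  obtain ⟨M, hM⟩ := hGb (t + 1)
  have hpair : ∀ s u, 0 ≤ s → 0 ≤ u → Measurable fun ω => G s ω (ξ u ω) := fun s u hs hu =>
    (measurable_from_prod_countable_left (f := fun p : Ω × Fin 2 => G s p.1 p.2)
      (hGm s hs)).comp (measurable_id.prodMk (h.switching.measurable hu))
  have hnear : ∀ᶠ s in 𝓝[Ici 0] t, s ∈ Icc 0 (t + 1) := by
    filter_upwards [self_mem_nhdsWithin,
      nhdsWithin_le_nhds (ge_mem_nhds (lt_add_one t))] with s h1 h2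
    exact ⟨h1, h2⟩
  have htm : t ∈ Icc 0 (t + 1) := ⟨ht, by linarith⟩
  have hM0 : ∀ ω : Ω, 0 ≤ M := fun ω => (abs_nonneg _).trans (hM t htm ω 0)
  -- With the state frozen at `ξ t` dominated convergence applies; replacing `ξ t` by `ξ s` costs at
  -- most `2 * M` times the probability that they differ.
  have h1 : Tendsto (fun s => ∫ ω, G s ω (ξ t ω) ∂P i) (𝓝[Ici 0] t)
      (𝓝 (∫ ω, G t ω (ξ t ω) ∂P i)) := by
    refine tendsto_integral_filter_of_dominated_convergence (fun _ => M) ?_ ?_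
      (integrable_const _) ?_
    · filter_upwards [hnear] with s hs
      exact (hpair s t hs.1 ht).aestronglyMeasurable
    · filter_upwards [hnear] with s hs
      exact Eventually.of_forall fun ω => hM s hs ω _
    · exact Eventually.of_forall fun ω => hGc ω _ t ht
  have h2 : Tendsto (fun s => ∫ ω, (G s ω (ξ s ω) - G s ω (ξ t ω)) ∂P i) (𝓝[Ici 0] t) (𝓝 0) := by
    have h3 := (h.tendsto_measureReal_ne ht i).const_mul (2 * M)
    rw [mul_zero] at h3
    refine squeeze_zero_norm' ?_ h3
    filter_upwards [hnear] with s hs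
    have hms : MeasurableSet {ω | ξ s ω ≠ ξ t ω} :=
      (measurableSet_eq_fun (h.switching.measurable hs.1) (h.switching.measurable ht)).compl
    rw [← integral_indicator_one hms, ← integral_const_mul]
    refine norm_integral_le_of_norm_le
      (((integrable_const (1 : ℝ)).indicator hms).const_mul _) (Eventually.of_forall fun ω => ?_)
    by_cases hω : ξ s ω = ξ t ω
    · simp [hω]
    · have e : indicator {ω | ξ s ω ≠ ξ t ω} (fun _ => (1 : ℝ)) ω = 1 := indicator_of_mem hω _
      change _ ≤ 2 * M * indicator {ω | ξ s ω ≠ ξ t ω} (fun _ => (1 : ℝ)) ω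
      rw [e, Real.norm_eq_abs]
      have := abs_sub (G s ω (ξ s ω)) (G s ω (ξ t ω))
      linarith [hM s hs ω (ξ s ω), hM s hs ω (ξ t ω)]
  have h4 := h2.add h1
  rw [zero_add] at h4
  refine h4.congr' ?_
  filter_upwards [hnear] with s hs
  have hi : ∀ u, 0 ≤ u → Integrable (fun ω => G s ω (ξ u ω)) (P i) := fun u hu =>
    Integrable.of_bound (hpair s u hs.1 hu).aestronglyMeasurable M
      (Eventually.of_forall fun ω => hM s hs ω _)
  rw [integral_sub (hi s hs.1) (hi t ht), sub_add_cancel]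

theorem continuousOn_semigroup (h : IsTelegraphFlow U c lam P ξ X) {f : ℝ → Fin 2 → ℝ}
    (hf : ∀ j, Continuous fun x => f x j) (x : ℝ) (i : Fin 2) :
    ContinuousOn (fun t => semigroup P ξ X f t x i) (Ici 0) := by
  refine h.continuousOn_integral i (G := fun t ω j => f (X x t ω) j)
    (fun t ht j => (hf j).measurable.comp (h.measurable x t ht))
    (fun ω j => (hf j).comp_continuousOn (h.solves x ω).cont) fun T => ?_
  obtain ⟨M, -, hM⟩ := h.exists_bound_family hf |x| T
  exact ⟨M, fun t ht ω j => hM x le_rfl t ht ω j⟩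

theorem continuousOn_semigroupDeriv (h : IsTelegraphFlow U c lam P ξ X) {f : ℝ → Fin 2 → ℝ}
    (hf : ∀ j, ContDiff ℝ 1 fun x => f x j) (x : ℝ) (i : Fin 2) :
    ContinuousOn (fun t => semigroupDeriv U P ξ X f t x i) (Ici 0) := by
  have hd : ∀ j, Continuous (deriv fun y => f y j) := fun j => (hf j).continuous_deriv le_rfl
  refine h.continuousOn_integral i
    (G := fun t ω j => deriv (fun y => f y j) (X x t ω) * flowSlope U X ω x x t)
    (fun t ht j => ((hd j).measurable.comp (h.measurable x t ht)).mul
      (h.measurable_flowSlope_self ht x))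
    (fun ω j => ((hd j).comp_continuousOn (h.solves x ω).cont).mul
      ((h.continuous_flowSlope ω).comp
        (by fun_prop : Continuous fun t : ℝ => ((x, x), t))).continuousOn) fun T => ?_
  obtain ⟨M, -, hM⟩ := h.exists_bound_deriv hf |x| T
  exact ⟨M, fun t ht ω j => hM x le_rfl t ht ω j⟩

theorem semigroup_add (h : IsTelegraphFlow U c lam P ξ X) {f : ℝ → Fin 2 → ℝ}
    (hf : ∀ j, Continuous fun x => f x j) {s t : ℝ} (hs : 0 ≤ s) (ht : 0 ≤ t) (x : ℝ)
    (i : Fin 2) : semigroup P ξ X f (s + t) x i =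
      semigroup P ξ X (fun y k => semigroup P ξ X f t y k) s x i := by
  simpa [semigroup] using h.integral_markov x hs ht i (H := fun _ => 1) measurable_const
    (M := 1) (fun _ => by simp) hf

/-- The backward equation, with the derivative from the right. -/
theorem hasDerivWithinAt_semigroup_right (h : IsTelegraphFlow U c lam P ξ X)
    {f : ℝ → Fin 2 → ℝ} (hf : ∀ j, ContDiff ℝ 1 fun x => f x j) {t : ℝ} (ht : 0 ≤ t) (x : ℝ)
    (i : Fin 2) :
    HasDerivWithinAt (fun s => semigroup P ξ X f s x i)
      (telegraphGenerator U c lam (fun y k => semigroup P ξ X f t y k) x i) (Ici t) t := by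
  refine hasDerivWithinAt_Ici_of_tendsto ?_
  have h1 := h.tendsto_generator (f := fun y k => semigroup P ξ X f t y k)
    (fun j => h.contDiff_semigroup hf ht j) x i
  have h2 : Tendsto (fun s : ℝ => (s, x)) (𝓝[>] 0) (𝓝[>] 0 ×ˢ 𝓝 x) :=
    tendsto_id.prodMk tendsto_const_nhds
  refine (h1.comp h2).congr' ?_
  filter_upwards [self_mem_nhdsWithin] with s hs
  -- The short time `s` comes first: `P_{s+t} f = P_s (P_t f)`, so the generator acts on the fixed
  -- function `P_t f`.
  rw [add_comm t s, h.semigroup_add (fun j => (hf j).continuous) (mem_Ioi.1 hs).le ht]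
  rfl

/-- The backward equation. -/
theorem hasDerivWithinAt_semigroup (h : IsTelegraphFlow U c lam P ξ X)
    {f : ℝ → Fin 2 → ℝ} (hf : ∀ j, ContDiff ℝ 1 fun x => f x j) {t : ℝ} (ht : 0 ≤ t) (x : ℝ)
    (i : Fin 2) :
    HasDerivWithinAt (fun s => semigroup P ξ X f s x i)
      (telegraphGenerator U c lam (fun y k => semigroup P ξ X f t y k) x i) (Ici 0) t := by
  have hfc : ∀ j, Continuous fun x => f x j := fun j => (hf j).continuous
  set g : ℝ → ℝ := fun s => telegraphGenerator U c lam (fun y k => semigroup P ξ X f s y k) x i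
    with hg
  -- Once the right derivative `g` is known to be continuous in time, `P_t f - ∫ g` is continuous
  -- with right derivative zero, hence constant, and the derivative becomes two-sided at `t > 0`.
  have hgc : ContinuousOn g (Ici 0) := by
    have e : EqOn g (fun s => (semigroup P ξ X f s x (1 - i) - semigroup P ξ X f s x i) * lam i +
        (c i - deriv U x) * semigroupDeriv U P ξ X f s x i) (Ici 0) := fun s hs => by
      simp only [hg, telegraphGenerator, driftOp, switchingMatrix_mulVec,
        (h.hasDerivAt_semigroup hf (mem_Ici.1 hs) x i).deriv]
    refine ContinuousOn.congr ?_ e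
    exact (((h.continuousOn_semigroup hfc x _).sub (h.continuousOn_semigroup hfc x _)).mul
      continuousOn_const).add (continuousOn_const.mul (h.continuousOn_semigroupDeriv hf x i))
  have hint : ∀ s, 0 ≤ s → HasDerivWithinAt (fun t => ∫ u in (0 : ℝ)..t, g u) (g s) (Ici 0) s :=
    fun s hs => SolvesTelegraphEquation.hasDerivWithinAt_integral hgc hs
  have heq : ∀ s ∈ Ici (0 : ℝ), semigroup P ξ X f s x i =
      semigroup P ξ X f 0 x i + ∫ u in (0 : ℝ)..s, g u := by
    intro s hs
    have hs0 : 0 ≤ s := hs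
    have := constant_of_has_deriv_right_zero (a := 0) (b := s)
      (f := fun s => semigroup P ξ X f s x i - ∫ u in (0 : ℝ)..s, g u)
      (((h.continuousOn_semigroup hfc x i).sub
        fun u hu => (hint u hu).continuousWithinAt).mono Icc_subset_Ici_self)
      (fun u hu => ((h.hasDerivWithinAt_semigroup_right hf hu.1 x i).sub
        ((hint u hu.1).mono (Ici_subset_Ici.2 hu.1))).congr_deriv (sub_self _))
      s ⟨hs0, le_rfl⟩
    simp only [intervalIntegral.integral_same, sub_zero] at this
    linarith
  exact ((hint t ht).const_add _).congr heq (heq t ht)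

/-! ### The transition kernel matrix -/

/-- The vector function with `φ` in the component `j` and `0` in the other one. -/
def component (φ : ℝ → ℝ) (j : Fin 2) (x : ℝ) (k : Fin 2) : ℝ :=
  if k = j then φ x else 0

theorem contDiff_component {φ : ℝ → ℝ} (hφ : ContDiff ℝ 1 φ) (j k : Fin 2) :
    ContDiff ℝ 1 fun x => component φ j x k := by
  unfold component
  split_ifs
  · exact hφ
  · exact contDiff_const

theorem continuous_component {φ : ℝ → ℝ} (hφ : Continuous φ) (j k : Fin 2) :
    Continuous fun x => component φ j x k := by
  unfold component
  split_ifs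
  · exact hφ
  · exact continuous_const

theorem integrable_transitionKernel (h : IsTelegraphFlow U c lam P ξ X) {φ : ℝ → ℝ}
    (hφ : Continuous φ) {t : ℝ} (ht : 0 ≤ t) (x : ℝ) (i j : Fin 2) :
    Integrable φ (transitionKernel P ξ X t x i j) := by
  rw [transitionKernel, integrable_map_measure hφ.aestronglyMeasurable
    (h.measurable x t ht).aemeasurable]
  exact (h.integrable_comp (f := fun x _ => φ x) (fun _ => hφ) ht x i).restrict

/-- This reduces the matrix equation to the vector equation, one column at a time. -/
theorem kernelMatrix_eq (h : IsTelegraphFlow U c lam P ξ X) {φ : ℝ → ℝ}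
    (hφ : Continuous φ) {t : ℝ} (ht : 0 ≤ t) (x : ℝ) (i j : Fin 2) :
    kernelMatrix P ξ X φ t x i j = semigroup P ξ X (component φ j) t x i := by
  rw [kernelMatrix, Matrix.of_apply, transitionKernel,
    integral_map (h.measurable x t ht).aemeasurable hφ.aestronglyMeasurable,
    ← integral_indicator (h.switching.measurableSet_eq ht j)]
  refine integral_congr_ae (Eventually.of_forall fun ω => ?_)
  simp [indicator_apply, component]

theorem telegraphGeneratorMatrix_apply (F : ℝ → Matrix (Fin 2) (Fin 2) ℝ) (x : ℝ) (i j : Fin 2) :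
    telegraphGeneratorMatrix U c lam F x i j =
      telegraphGenerator U c lam (fun y k => F y k j) x i := rfl

theorem hasDerivWithinAt_kernelMatrix (h : IsTelegraphFlow U c lam P ξ X) {φ : ℝ → ℝ}
    (hφ : ContDiff ℝ 1 φ) {t : ℝ} (ht : 0 ≤ t) (x : ℝ) (i j : Fin 2) :
    HasDerivWithinAt (fun s => kernelMatrix P ξ X φ s x i j)
      (telegraphGeneratorMatrix U c lam (kernelMatrix P ξ X φ t) x i j) (Ici 0) t := by
  rw [telegraphGeneratorMatrix_apply]
  simp only [h.kernelMatrix_eq hφ.continuous ht]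
  exact (h.hasDerivWithinAt_semigroup (contDiff_component hφ j) ht x i).congr
    (fun s hs => h.kernelMatrix_eq hφ.continuous hs x i j)
    (h.kernelMatrix_eq hφ.continuous ht x i j)

theorem semigroup_zero (h : IsTelegraphFlow U c lam P ξ X) (f : ℝ → Fin 2 → ℝ) (x : ℝ)
    (i : Fin 2) : semigroup P ξ X f 0 x i = f x i := by
  have := h.isProbabilityMeasure
  have e : ∀ᵐ ω ∂P i, f (X x 0 ω) (ξ 0 ω) = f x i := by
    filter_upwards [h.switching.markov.start i] with ω hω
    rw [hω, h.apply_zero]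
  rw [semigroup, integral_congr_ae e]
  simp

theorem transitionKernel_zero (h : IsTelegraphFlow U c lam P ξ X) (x : ℝ) (i j : Fin 2) :
    transitionKernel P ξ X 0 x i j = if i = j then Measure.dirac x else 0 := by
  have := h.isProbabilityMeasure
  have hX : X x 0 = fun _ => x := funext fun ω => h.apply_zero x ω
  have e : P i {ω | ξ 0 ω = j} = P i {_ω | i = j} := by
    refine measure_congr ?_
    filter_upwards [h.switching.markov.start i] with ω hω
    refine propext ?_
    change ξ 0 ω = j ↔ i = j
    rw [hω]
  rw [transitionKernel, hX, Measure.map_const, Measure.restrict_apply_univ, e]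
  split_ifs with hij <;> simp [hij]

theorem tendsto_kernelMatrix (h : IsTelegraphFlow U c lam P ξ X) {φ : ℝ → ℝ}
    (hφ : Continuous φ) (x : ℝ) (i j : Fin 2) :
    Tendsto (fun t => kernelMatrix P ξ X φ t x i j) (𝓝[>] 0)
      (𝓝 (if i = j then φ x else 0)) := by
  have h1 := (h.continuousOn_semigroup (continuous_component hφ j) x i 0 self_mem_Ici).mono_left
    (nhdsWithin_mono _ Ioi_subset_Ici_self)
  simp only [h.semigroup_zero] at h1
  refine h1.congr' ?_
  filter_upwards [self_mem_nhdsWithin] with t ht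
  exact (h.kernelMatrix_eq hφ (mem_Ioi.1 ht).le x i j).symm

end IsTelegraphFlow

/-! ### Assembly of the theorem -/

theorem mainTheorem4 {Ω : Type*} [MeasurableSpace Ω]
    (U : ℝ → ℝ) (xm x0 xp : ℝ) (hU : IsDoubleWell U xm x0 xp)
    (c lam : Fin 2 → ℝ) (hc : c 1 < c 0) (hlam : ∀ i, 0 < lam i)
    (P : Fin 2 → Measure Ω) (ξ : ℝ → Ω → Fin 2) (hξ : IsSwitchingProcess lam P ξ)
    (X : ℝ → ℝ → Ω → ℝ) (hXmeas : ∀ x t, 0 ≤ t → Measurable (X x t))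
    (hX : ∀ x ω, SolvesTelegraphEquation U c (fun s => ξ s ω) x (fun s => X x s ω)) :
    -- `Λ` is the generator of `ξ`
    (∀ i j, HasDerivWithinAt (fun t : ℝ => (P i).real {ω | ξ t ω = j})
      (switchingMatrix lam i j) (Ici 0) 0) ∧
    -- `Ξ` is a Markov process
    IsMarkovFamily (fun z : ℝ × Fin 2 => P z.2) (jointProcess ξ X) ∧
    -- the generator of `Ξ` is `Λ + 𝓛`
    (∀ f : ℝ → Fin 2 → ℝ, (∀ j, ContDiff ℝ 1 (fun x => f x j)) →
      (∀ t, 0 ≤ t → ∀ z : ℝ × Fin 2,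
        Integrable (fun ω => f (X z.1 t ω) (ξ t ω)) (P z.2)) ∧
      TendstoLocallyUniformly
        (fun (h : ℝ) (z : ℝ × Fin 2) =>
          (markovSemigroup (fun z : ℝ × Fin 2 => P z.2) (jointProcess ξ X) h
            (fun w => f w.1 w.2) z - f z.1 z.2) / h)
        (fun z => telegraphGenerator U c lam f z.1 z.2) (𝓝[>] 0) ∧
      ((∀ j, HasCompactSupport (fun x => f x j)) →
        TendstoUniformly
          (fun (h : ℝ) (z : ℝ × Fin 2) =>
            (markovSemigroup (fun z : ℝ × Fin 2 => P z.2) (jointProcess ξ X) h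
              (fun w => f w.1 w.2) z - f z.1 z.2) / h)
          (fun z => telegraphGenerator U c lam f z.1 z.2) (𝓝[>] 0))) ∧
    -- the transition kernel matrix satisfies `∂𝓟/∂t = (Λ + 𝓛^x) 𝓟`
    (∀ φ : ℝ → ℝ, ContDiff ℝ 1 φ →
      (∀ t x, 0 ≤ t → ∀ i j, Integrable φ (transitionKernel P ξ X t x i j)) ∧
      (∀ t, 0 ≤ t → ∀ i j, ContDiff ℝ 1 (fun x => kernelMatrix P ξ X φ t x i j)) ∧
      (∀ t x, 0 ≤ t → ∀ i j,
        HasDerivWithinAt (fun s => kernelMatrix P ξ X φ s x i j)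
          (telegraphGeneratorMatrix U c lam (kernelMatrix P ξ X φ t) x i j) (Ici 0) t)) ∧
    -- the initial condition
    (∀ x i j, transitionKernel P ξ X 0 x i j = if i = j then Measure.dirac x else 0) ∧
    (∀ φ : ℝ → ℝ, Continuous φ → ∀ x i j,
      Tendsto (fun t => kernelMatrix P ξ X φ t x i j) (𝓝[>] 0)
        (𝓝 (if i = j then φ x else 0))) := by
  have h : IsTelegraphFlow U c lam P ξ X :=
    -- `U` of class `C²` means that `U'` is of class `C¹`, which is the form used throughout.
    { contDiff := (contDiff_succ_iff_deriv (n := 1)).1 (by simpa [one_add_one_eq_two] using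
        hU.contDiff) |>.2.2
      le := hc.le
      switching := hξ
      measurable := hXmeas
      solves := hX }
  refine ⟨hξ.hasDerivWithinAt_measureReal, h.isMarkovFamily, fun f hf => ⟨?_, ?_, ?_⟩,
    fun φ hφ => ⟨?_, ?_, ?_⟩, h.transitionKernel_zero, fun φ hφ => h.tendsto_kernelMatrix hφ⟩
  · exact fun t ht z => h.integrable_comp (fun j => (hf j).continuous) ht z.1 z.2
  · exact h.tendstoLocallyUniformly_generator hf
  · exact h.tendstoUniformly_generator hf
  · exact fun t x ht => h.integrable_transitionKernel hφ.continuous ht x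
  · intro t ht i j
    simp only [h.kernelMatrix_eq hφ.continuous ht]
    exact h.contDiff_semigroup (IsTelegraphFlow.contDiff_component hφ j) ht i
  · exact fun t x ht => h.hasDerivWithinAt_kernelMatrix hφ ht x
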